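/- Let $(N,\phi,\xi,\eta,g)$ be a $(2n+1)$-dimensional cosymplectic manifold. That is, $N$ is a $C^\infty$ manifold with a smooth $(1,1)$-tensor field $\phi$, a smooth vector field $\xi$, a smooth $1$-form $\eta$ and a Riemannian metric $g$ such that $\phi^2=-I+\eta\otimes\xi$, $\eta(\xi)=1$ and $g(\phi X,\phi Y)=g(X,Y)-\eta(X)\eta(Y)$; the forms $\eta$ and $\Phi(X,Y)=g(X,\phi Y)$ are closed; and $N_\phi+2\,d\eta\otimes\xi=0$, where $N_\phi(X,Y)=\phi^2[X,Y]+[\phi X,\phi Y]-\phi[\phi X,Y]-\phi[X,\phi Y]$. Let $M$ be a connected (immersed) submanifold of $N$ that is totally geodesic, i.e. its second fundamental form with respect to the Levi-Civita connection of $g$ vanishes identically. For $p\in M$ put $M_p=\{X\in T_pM : g(X,\xi(p))=0\}$. Suppose that $M$ is pointwise slant: there is a function $\theta:M\to\mathbb{R}$ (a slant function) such that for every $p\in M$ and every nonzero $X\in M_p$ the angle between $\phi X$ and the subspace $M_p$ equals $\theta(p)$. Then $M$ is slant: there is a constant $\theta_0$ such that for every $p\in M$ and every nonzero $X\in M_p$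 the angle between $\phi X$ and $M_p$ equals $\theta_0$. -/

import Mathlib

open Bundle Manifold
open scoped ContDiff Manifold

namespace SlantGeometry

/-! ### The Levi-Civita connection of a Riemannian manifold -/

section LeviCivita

variable {E : Type*} [NormedAddCommGroup E] [NormedSpace ℝ E]
  {H : Type*} [TopologicalSpace H] {I : ModelWithCorners ℝ E H}
  {N : Type*} [TopologicalSpace N] [ChartedSpace H N]

instance instFiniteDimensionalTangentSpace [FiniteDimensional ℝ E] (x : N) :
    FiniteDimensional ℝ (TangentSpace I x) :=
  inferInstanceAs (FiniteDimensional ℝ E)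

variable [RiemannianBundle (fun x : N => TangentSpace I x)]

/-- The Koszul expression
`X⟨Y,Z⟩ + Y⟨Z,X⟩ - Z⟨X,Y⟩ + ⟨[X,Y],Z⟩ - ⟨[X,Z],Y⟩ - ⟨[Y,Z],X⟩`, evaluated at `x`. -/
noncomputable def koszul (X Y Z : Π x : N, TangentSpace I x) (x : N) : ℝ :=
  mvfderiv I (fun y => inner ℝ (Y y) (Z y)) x (X x)
    + mvfderiv I (fun y => inner ℝ (Z y) (X y)) x (Y x)
    - mvfderiv I (fun y => inner ℝ (X y) (Y y)) x (Z x)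
    + inner ℝ (VectorField.mlieBracket I X Y x) (Z x)
    - inner ℝ (VectorField.mlieBracket I X Z x) (Y x)
    - inner ℝ (VectorField.mlieBracket I Y Z x) (X x)

/-- The endomorphism `A` of an inner product space with `⟨A v, w⟩ = B v w`. -/
noncomputable def rieszMap {V : Type*} [NormedAddCommGroup V] [InnerProductSpace ℝ V]
    [CompleteSpace V] (B : V →L[ℝ] V →L[ℝ] ℝ) : V →L[ℝ] V :=
  LinearMap.mkContinuous
    { toFun := fun v => (InnerProductSpace.toDual ℝ V).symm (B v)
      map_add' := fun v w => by simp
      map_smul' := fun c v => by simp } ‖B‖ (fun v => by simpa using B.le_opNorm v)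

theorem inner_rieszMap {V : Type*} [NormedAddCommGroup V] [InnerProductSpace ℝ V]
    [CompleteSpace V] (B : V →L[ℝ] V →L[ℝ] ℝ) (v w : V) :
    inner ℝ (rieszMap B v) w = B v w := by
  simp [rieszMap]

variable [FiniteDimensional ℝ E] [IsManifold I ∞ N]
  [IsContMDiffRiemannianBundle I ∞ E (fun x : N => TangentSpace I x)]

theorem mdiffAt_inner {X Y : Π x : N, TangentSpace I x} {x : N}
    (hX : MDiffAt (T% X) x) (hY : MDiffAt (T% Y) x) :
    MDiffAt (fun y => (inner ℝ (X y) (Y y) : ℝ)) x :=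
  MDifferentiableAt.inner_bundle (E := fun x : N => TangentSpace I x) hX hY

theorem koszul_add_left {X X' Y Z : Π x : N, TangentSpace I x} {x : N}
    (hX : MDiffAt (T% X) x) (hX' : MDiffAt (T% X') x)
    (hY : MDiffAt (T% Y) x) (hZ : MDiffAt (T% Z) x) :
    koszul (X + X') Y Z x = koszul X Y Z x + koszul X' Y Z x := by
  have h1 := mvfderiv_fun_add (mdiffAt_inner hZ hX) (mdiffAt_inner hZ hX')
  have h2 := mvfderiv_fun_add (mdiffAt_inner hX hY) (mdiffAt_inner hX' hY)
  simp [koszul, inner_add_left, inner_add_right, VectorField.mlieBracket_add_left hX hX', h1, h2]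
  ring

theorem koszul_smul_left {f : N → ℝ} {X Y Z : Π x : N, TangentSpace I x} {x : N}
    (hf : MDiffAt f x) (hX : MDiffAt (T% X) x)
    (hY : MDiffAt (T% Y) x) (hZ : MDiffAt (T% Z) x) :
    koszul (f • X) Y Z x = f x * koszul X Y Z x := by
  have h1 := mvfderiv_fun_mul hf (mdiffAt_inner hZ hX)
  have h2 := mvfderiv_fun_mul hf (mdiffAt_inner hX hY)
  simp [koszul, inner_add_left, inner_smul_left, inner_smul_right,
    VectorField.mlieBracket_smul_left hf hX, h1, h2]
  rw [real_inner_comm (Y x) (X x), real_inner_comm (Z x) (X x)]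
  ring

theorem koszul_add_right {X Y Z Z' : Π x : N, TangentSpace I x} {x : N}
    (hX : MDiffAt (T% X) x) (hY : MDiffAt (T% Y) x)
    (hZ : MDiffAt (T% Z) x) (hZ' : MDiffAt (T% Z') x) :
    koszul X Y (Z + Z') x = koszul X Y Z x + koszul X Y Z' x := by
  have h1 := mvfderiv_fun_add (mdiffAt_inner hY hZ) (mdiffAt_inner hY hZ')
  have h2 := mvfderiv_fun_add (mdiffAt_inner hZ hX) (mdiffAt_inner hZ' hX)
  simp [koszul, inner_add_left, inner_add_right, VectorField.mlieBracket_add_right hZ hZ', h1, h2]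
  ring

theorem koszul_smul_right {f : N → ℝ} {X Y Z : Π x : N, TangentSpace I x} {x : N}
    (hf : MDiffAt f x) (hX : MDiffAt (T% X) x)
    (hY : MDiffAt (T% Y) x) (hZ : MDiffAt (T% Z) x) :
    koszul X Y (f • Z) x = f x * koszul X Y Z x := by
  have h1 := mvfderiv_fun_mul hf (mdiffAt_inner hY hZ)
  have h2 := mvfderiv_fun_mul hf (mdiffAt_inner hZ hX)
  simp [koszul, inner_add_left, inner_smul_left, inner_smul_right,
    VectorField.mlieBracket_smul_right hf hZ, h1, h2]
  rw [real_inner_comm (Y x) (Z x)]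
  ring

theorem koszul_add_middle {X Y Y' Z : Π x : N, TangentSpace I x} {x : N}
    (hX : MDiffAt (T% X) x) (hY : MDiffAt (T% Y) x)
    (hY' : MDiffAt (T% Y') x) (hZ : MDiffAt (T% Z) x) :
    koszul X (Y + Y') Z x = koszul X Y Z x + koszul X Y' Z x := by
  have h1 := mvfderiv_fun_add (mdiffAt_inner hY hZ) (mdiffAt_inner hY' hZ)
  have h2 := mvfderiv_fun_add (mdiffAt_inner hX hY) (mdiffAt_inner hX hY')
  simp [koszul, inner_add_left, inner_add_right, VectorField.mlieBracket_add_right hY hY',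
    VectorField.mlieBracket_add_left hY hY', h1, h2]
  ring

theorem koszul_smul_middle {f : N → ℝ} {X Y Z : Π x : N, TangentSpace I x} {x : N}
    (hf : MDiffAt f x) (hX : MDiffAt (T% X) x)
    (hY : MDiffAt (T% Y) x) (hZ : MDiffAt (T% Z) x) :
    koszul X (f • Y) Z x
      = f x * koszul X Y Z x + 2 * (mvfderiv I f x (X x) * inner ℝ (Y x) (Z x)) := by
  have h1 := mvfderiv_fun_mul hf (mdiffAt_inner hY hZ)
  have h2 := mvfderiv_fun_mul hf (mdiffAt_inner hX hY)
  simp [koszul, inner_add_left, inner_smul_left, inner_smul_right,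
    VectorField.mlieBracket_smul_right hf hY, VectorField.mlieBracket_smul_left hf hY, h1, h2]
  rw [real_inner_comm (Y x) (X x)]
  ring

/-- For `Y` differentiable at `x`, the Koszul expression as a bilinear form in the values of
`X` and `Z` at `x`. -/
noncomputable def koszulForm (Y : Π x : N, TangentSpace I x) (x : N) (hY : MDiffAt (T% Y) x) :
    TangentSpace I x →L[ℝ] TangentSpace I x →L[ℝ] ℝ :=
  TensorialAt.mkHom₂ (I := I) (F := E) (F' := E) (fun X Z => koszul X Y Z x) x
    (fun _ hZ => ⟨fun hf hX => koszul_smul_left hf hX hY hZ,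
      fun hX hX' => koszul_add_left hX hX' hY hZ⟩)
    (fun _ hX => ⟨fun hf hZ => koszul_smul_right hf hX hY hZ,
      fun hZ hZ' => koszul_add_right hX hY hZ hZ'⟩)

open Classical in
/-- `lcFun Y x v = (∇_v Y)(x)`, defined by the Koszul formula `2⟨∇_X Y, Z⟩ = koszul X Y Z`
(and as `0` if `Y` is not differentiable at `x`). -/
noncomputable def lcFun (Y : Π x : N, TangentSpace I x) (x : N) :
    TangentSpace I x →L[ℝ] TangentSpace I x :=
  haveI : CompleteSpace (TangentSpace I x) := FiniteDimensional.complete ℝ _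
  if hY : MDiffAt (T% Y) x then (2⁻¹ : ℝ) • rieszMap (koszulForm Y x hY) else 0

theorem inner_lcFun {X Y Z : Π x : N, TangentSpace I x} {x : N}
    (hX : MDiffAt (T% X) x) (hY : MDiffAt (T% Y) x) (hZ : MDiffAt (T% Z) x) :
    inner ℝ (lcFun Y x (X x)) (Z x) = 2⁻¹ * koszul X Y Z x := by
  have : CompleteSpace (TangentSpace I x) := FiniteDimensional.complete ℝ _
  simp only [lcFun, hY, dite_true, smul_apply, real_inner_smul_left,
    inner_rieszMap, koszulForm]
  rw [TensorialAt.mkHom₂_apply (I := I) (F := E) (F' := E) _ _ hX hZ]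

theorem lcFun_ext {x : N} {A B : TangentSpace I x →L[ℝ] TangentSpace I x}
    (h : ∀ X Z : Π x : N, TangentSpace I x, MDiffAt (T% X) x → MDiffAt (T% Z) x →
      inner ℝ (A (X x)) (Z x) = (inner ℝ (B (X x)) (Z x) : ℝ)) : A = B := by
  ext v
  refine ext_inner_right ℝ fun w => ?_
  simpa using h (FiberBundle.extend E v) (FiberBundle.extend E w)
    (FiberBundle.mdifferentiableAt_extend ..) (FiberBundle.mdifferentiableAt_extend ..)

/-- The Levi-Civita connection; `leviCivita Y x v` is `∇_v Y` at `x`. -/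
noncomputable def leviCivita :
    CovariantDerivative I E (fun x : N => TangentSpace I x) where
  toFun := lcFun
  isCovariantDerivativeOnUniv :=
    { add := fun {Y Y' x} hY hY' _ => lcFun_ext fun X Z hX hZ => by
        rw [inner_lcFun hX (mdifferentiableAt_add_section hY hY') hZ, add_apply,
          inner_add_left, inner_lcFun hX hY hZ, inner_lcFun hX hY' hZ,
          koszul_add_middle hX hY hY' hZ]
        ring
      leibniz := fun {Y f x} hY hf _ => lcFun_ext fun X Z hX hZ => by
        rw [inner_lcFun hX (hf.smul_section hY) hZ, add_apply,
          inner_add_left, smul_apply, ContinuousLinearMap.smulRight_apply,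
          real_inner_smul_left, real_inner_smul_left, inner_lcFun hX hY hZ,
          koszul_smul_middle hf hX hY hZ]
        ring }

theorem inner_leviCivita {X Y Z : Π x : N, TangentSpace I x} {x : N}
    (hX : MDiffAt (T% X) x) (hY : MDiffAt (T% Y) x) (hZ : MDiffAt (T% Z) x) :
    2 * inner ℝ (leviCivita Y x (X x)) (Z x) = koszul X Y Z x := by
  rw [show (leviCivita Y x (X x)) = lcFun Y x (X x) from rfl, inner_lcFun hX hY hZ]
  ring

/-- The Levi-Civita connection is torsion-free. -/
theorem leviCivita_torsion {X Y : Π x : N, TangentSpace I x} {x : N}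
    (hX : MDiffAt (T% X) x) (hY : MDiffAt (T% Y) x) :
    leviCivita Y x (X x) - leviCivita X x (Y x) = VectorField.mlieBracket I X Y x := by
  have key : ∀ Z : Π x : N, TangentSpace I x, MDiffAt (T% Z) x →
      inner ℝ (leviCivita Y x (X x) - leviCivita X x (Y x)) (Z x)
        = (inner ℝ (VectorField.mlieBracket I X Y x) (Z x) : ℝ) := by
    intro Z hZ
    have h1 := inner_leviCivita hX hY hZ
    have h2 := inner_leviCivita hY hX hZ
    have e (A B : Π x : N, TangentSpace I x) : (fun y => (inner ℝ (A y) (B y) : ℝ))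
        = fun y => inner ℝ (B y) (A y) := funext fun y => real_inner_comm _ _
    rw [koszul] at h1 h2
    rw [e Z X] at h1
    rw [e Z Y, e Y X, VectorField.mlieBracket_swap_apply (V := Y) (W := X), inner_neg_left] at h2
    rw [inner_sub_left]
    linarith
  refine ext_inner_right ℝ fun w => ?_
  simpa using key (FiberBundle.extend E w) (FiberBundle.mdifferentiableAt_extend ..)

/-- The Levi-Civita connection is compatible with the metric. -/
theorem leviCivita_metric {X Y Z : Π x : N, TangentSpace I x} {x : N}
    (hX : MDiffAt (T% X) x) (hY : MDiffAt (T% Y) x) (hZ : MDiffAt (T% Z) x) :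
    mvfderiv I (fun y => inner ℝ (Y y) (Z y)) x (X x)
      = inner ℝ (leviCivita Y x (X x)) (Z x) + inner ℝ (Y x) (leviCivita Z x (X x)) := by
  have h1 := inner_leviCivita hX hY hZ
  have h2 := inner_leviCivita hX hZ hY
  have e (A B : Π x : N, TangentSpace I x) : (fun y => (inner ℝ (A y) (B y) : ℝ))
      = fun y => inner ℝ (B y) (A y) := funext fun y => real_inner_comm _ _
  rw [koszul] at h1 h2
  rw [e Z X] at h1
  rw [e Z Y, e Y X, VectorField.mlieBracket_swap_apply (V := Z) (W := Y), inner_neg_left] at h2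
  rw [real_inner_comm (leviCivita Z x (X x)) (Y x)]
  linarith

end LeviCivita

/-! ### Almost contact metric structures and cosymplectic manifolds -/

section Contact

variable {E : Type*} [NormedAddCommGroup E] [NormedSpace ℝ E]
  {H : Type*} [TopologicalSpace H] (I : ModelWithCorners ℝ E H)
  {N : Type*} [TopologicalSpace N] [ChartedSpace H N]

variable {I} in
/-- The exterior derivative of a one-form `α`, evaluated on vector fields:
`2 dα(X, Y) = X(α(Y)) - Y(α(X)) - α([X, Y])`. -/
noncomputable def extDerivOneForm (α : Π x : N, TangentSpace I x → ℝ)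
    (X Y : Π x : N, TangentSpace I x) (x : N) : ℝ :=
  (1 / 2) * (mvfderiv I (fun y => α y (Y y)) x (X x)
    - mvfderiv I (fun y => α y (X y)) x (Y x)
    - α x (VectorField.mlieBracket I X Y x))

variable {I} in
/-- The exterior derivative of a two-form `Ω`, evaluated on vector fields (in the same
normalization): `3 dΩ(X, Y, Z)` is the cyclic sum of `X(Ω(Y, Z)) - Ω([X, Y], Z)`. -/
noncomputable def extDerivTwoForm (Ω : Π x : N, TangentSpace I x → TangentSpace I x → ℝ)
    (X Y Z : Π x : N, TangentSpace I x) (x : N) : ℝ :=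
  (1 / 3) * (mvfderiv I (fun y => Ω y (Y y) (Z y)) x (X x)
    + mvfderiv I (fun y => Ω y (Z y) (X y)) x (Y x)
    + mvfderiv I (fun y => Ω y (X y) (Y y)) x (Z x)
    - Ω x (VectorField.mlieBracket I X Y x) (Z x)
    - Ω x (VectorField.mlieBracket I Y Z x) (X x)
    - Ω x (VectorField.mlieBracket I Z X x) (Y x))

variable {I} in
/-- The Nijenhuis tensor of a field of endomorphisms, evaluated on vector fields:
`φ²[X,Y] + [φX,φY] - φ[φX,Y] - φ[X,φY]`. -/
noncomputable def nijenhuis (φ : Π x : N, TangentSpace I x →L[ℝ] TangentSpace I x)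
    (X Y : Π x : N, TangentSpace I x) (x : N) : TangentSpace I x :=
  φ x (φ x (VectorField.mlieBracket I X Y x))
    + VectorField.mlieBracket I (fun y => φ y (X y)) (fun y => φ y (Y y)) x
    - φ x (VectorField.mlieBracket I (fun y => φ y (X y)) Y x)
    - φ x (VectorField.mlieBracket I X (fun y => φ y (Y y)) x)

variable [IsManifold I ∞ N] [RiemannianBundle (fun x : N => TangentSpace I x)]

variable (N) in
/-- An almost contact metric structure `(φ, ξ, η, g)` on `N`, where `g` is the Riemannian metric
that `N` carries. -/
structure AlmostContactMetricStructure where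
  /-- the tensor field of type `(1,1)` -/
  φ : Π x : N, TangentSpace I x →L[ℝ] TangentSpace I x
  /-- the characteristic vector field -/
  ξ : Π x : N, TangentSpace I x
  /-- the one-form -/
  η : Π x : N, TangentSpace I x →L[ℝ] ℝ
  contMDiff_φ : ContMDiff I (I.prod 𝓘(ℝ, E →L[ℝ] E)) ∞
    (fun x => TotalSpace.mk' (E →L[ℝ] E)
      (E := fun x : N => TangentSpace I x →L[ℝ] TangentSpace I x) x (φ x))
  contMDiff_ξ : ContMDiff I (I.prod 𝓘(ℝ, E)) ∞
    (fun x => TotalSpace.mk' E (E := fun x : N => TangentSpace I x) x (ξ x))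
  contMDiff_η : ContMDiff I (I.prod 𝓘(ℝ, E →L[ℝ] ℝ)) ∞
    (fun x => TotalSpace.mk' (E →L[ℝ] ℝ)
      (E := fun x : N => TangentSpace I x →L[ℝ] Bundle.Trivial N ℝ x) x (η x))
  φ_sq : ∀ (x : N) (v : TangentSpace I x), φ x (φ x v) = -v + η x v • ξ x
  η_ξ : ∀ x : N, η x (ξ x) = 1
  inner_φ_φ : ∀ (x : N) (v w : TangentSpace I x),
    inner ℝ (φ x v) (φ x w) = inner ℝ v w - η x v * η x w

variable {I}

namespace AlmostContactMetricStructure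

variable (S : AlmostContactMetricStructure I N)

/-- The fundamental two-form `Φ(X, Y) = g(X, φ Y)`. -/
noncomputable def fundamentalForm (x : N) (v w : TangentSpace I x) : ℝ :=
  inner ℝ v (S.φ x w)

/-- `η` and `Φ` are closed. -/
def IsAlmostCosymplectic : Prop :=
  (∀ (x : N) (X Y : Π x : N, TangentSpace I x),
    CMDiffAt ∞ (T% X) x → CMDiffAt ∞ (T% Y) x →
      extDerivOneForm (fun y => S.η y) X Y x = 0) ∧
  (∀ (x : N) (X Y Z : Π x : N, TangentSpace I x),
    CMDiffAt ∞ (T% X) x → CMDiffAt ∞ (T% Y) x → CMDiffAt ∞ (T% Z) x →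
      extDerivTwoForm S.fundamentalForm X Y Z x = 0)

/-- Normality: `N_φ + 2 dη ⊗ ξ = 0`. -/
def IsNormal : Prop :=
  ∀ (x : N) (X Y : Π x : N, TangentSpace I x),
    CMDiffAt ∞ (T% X) x → CMDiffAt ∞ (T% Y) x →
      nijenhuis S.φ X Y x + (2 * extDerivOneForm (fun y => S.η y) X Y x) • S.ξ x = 0

/-- A cosymplectic structure is a normal almost cosymplectic structure. -/
def IsCosymplectic : Prop := S.IsAlmostCosymplectic ∧ S.IsNormal

end AlmostContactMetricStructure

end Contact

/-! ### Immersed submanifolds -/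

section Submanifold

variable {E : Type*} [NormedAddCommGroup E] [NormedSpace ℝ E] [FiniteDimensional ℝ E]
  {H : Type*} [TopologicalSpace H] {I : ModelWithCorners ℝ E H}
  {N : Type*} [TopologicalSpace N] [ChartedSpace H N]
  {E' : Type*} [NormedAddCommGroup E'] [NormedSpace ℝ E']
  {H' : Type*} [TopologicalSpace H'] (J : ModelWithCorners ℝ E' H')
  {M : Type*} [TopologicalSpace M] [ChartedSpace H' M]

variable (I) in
/-- The tangent space of the immersed submanifold `f : M → N` at `p`, as a subspace of the
tangent space of `N` at `f p`. -/
noncomputable def tangentSubspace (f : M → N) (p : M) : Submodule ℝ (TangentSpace I (f p)) :=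
  LinearMap.range (mfderiv J I f p : TangentSpace J p →ₗ[ℝ] TangentSpace I (f p))

variable [RiemannianBundle (fun x : N => TangentSpace I x)]

/-- For a vector field `V` on `N` that extends a tangent vector field `Y` of the submanifold near
`p`, and `v` tangent to `M` at `p`, this is the second fundamental form `h(v, Y p)`: the normal
component of `∇_v V`. -/
noncomputable def secondFundamentalForm [IsManifold I ∞ N]
    [IsContMDiffRiemannianBundle I ∞ E (fun x : N => TangentSpace I x)]
    (f : M → N) (p : M) (v : TangentSpace J p) (V : Π x : N, TangentSpace I x) :
    TangentSpace I (f p) :=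
  (tangentSubspace I J f p)ᗮ.starProjection (leviCivita V (f p) (mfderiv J I f p v))

variable (I) in
/-- The second fundamental form of the submanifold vanishes identically. -/
def IsTotallyGeodesic [IsManifold I ∞ N] [IsManifold J ∞ M]
    [IsContMDiffRiemannianBundle I ∞ E (fun x : N => TangentSpace I x)] (f : M → N) : Prop :=
  ∀ (p : M) (v : TangentSpace J p) (Y : Π q : M, TangentSpace J q)
    (V : Π x : N, TangentSpace I x),
    CMDiffAt ∞ (T% Y) p → CMDiffAt ∞ (T% V) (f p) →
    (∀ᶠ q in nhds p, V (f q) = mfderiv J I f q (Y q)) →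
      secondFundamentalForm J f p v V = 0

/-- The angle in `[0, π/2]` between a vector and a subspace: the angle between the vector and its
orthogonal projection (`π/2` if that projection vanishes). -/
noncomputable def angleWithSubspace {V : Type*} [NormedAddCommGroup V] [InnerProductSpace ℝ V]
    (v : V) (W : Submodule ℝ V) [W.HasOrthogonalProjection] : ℝ :=
  InnerProductGeometry.angle v (W.starProjection v)

variable [IsManifold I ∞ N] (S : AlmostContactMetricStructure I N)

/-- `M_p`, the space of vectors tangent to the submanifold at `p` and orthogonal to `ξ`. -/
noncomputable def slantSubspace (f : M → N) (p : M) : Submodule ℝ (TangentSpace I (f p)) :=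
  tangentSubspace I J f p ⊓ (Submodule.span ℝ {S.ξ (f p)})ᗮ

/-- `θ` is a slant function: at each `p` the angle between `φ X` and `M_p` equals `θ p` for all
nonzero `X ∈ M_p`. -/
def IsSlantFunction (f : M → N) (θ : M → ℝ) : Prop :=
  ∀ (p : M), ∀ X ∈ slantSubspace J S f p, X ≠ 0 →
    angleWithSubspace (S.φ (f p) X) (slantSubspace J S f p) = θ p

/-- The submanifold is pointwise slant: it has a slant function. -/
def IsPointwiseSlant (f : M → N) : Prop := ∃ θ : M → ℝ, IsSlantFunction J S f θ

/-- The submanifold is slant: it has a constant slant function. -/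
def IsSlant (f : M → N) : Prop := ∃ θ₀ : ℝ, IsSlantFunction J S f (fun _ => θ₀)

end Submanifold

end SlantGeometry

/-! On a cosymplectic manifold `φ` is parallel: closedness of `η` and `Φ`, normality and the
algebraic relations force `∇ξ = 0` and then `∇φ = 0` (`eq_zero_of_cosymplectic_identities`,
`IsCosymplectic.nablaφ_eq_zero`). Hence `φ² + 1 = η ⊗ ξ` is parallel as well.

Total geodesy means that the ambient connection preserves the tangent spaces of `M`: a coordinate
frame of `M` is differentiated along `M` by a matrix `Γ`, with no normal part
(`exists_christoffel`). The restrictions to `M` of `g`, `g(·, φ ·)` and `η ⊗ η` are therefore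
parallel, so their matrices `B` satisfy `B' = Γᵀ B + B Γ` along a path. Multiplication by the
inverse Gram matrix turns them into operators with `X' = XΓ - ΓX`, whose traces, and the traces of
whose products, are constant (`trace_eq_of_formTransport`).

Let `P` be the projection to `M_p` and `T = PφP`. As `φ` is skew and isometric on the orthogonal
complement of `ξ`, the slant condition says exactly that `T² = -cos²θ P` (`starProjection_skew_sq`).
Thus `tr T² = -cos²θ · tr P`. Both traces are constant along coordinate segments, so where `M_p ≠ 0`
so is `cos²θ`. Angles with a subspace have nonnegative cosine, so `θ` itself is locally constant,
and connectedness of `M` finishes. -/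

namespace SlantGeometry

/-! ### Parallel forms and operators in a moving frame -/

section MatrixTransport

open scoped Matrix.Norms.Operator

variable {ι : Type*} [Fintype ι] [DecidableEq ι]

/-- In coordinates with Gram matrix `G`, the orthogonal projection onto the kernel of a form `t`,
where `W = t ⊗ t`. -/
noncomputable def kernelProjMatrix (G W : Matrix ι ι ℝ) : Matrix ι ι ℝ :=
  1 - (G⁻¹ * W).trace⁻¹ • (G⁻¹ * W)

/-- The compression of the operator with matrix `G⁻¹ F` to the range of `kernelProjMatrix G W`. -/
noncomputable def compressedMatrix (G F W : Matrix ι ι ℝ) : Matrix ι ι ℝ :=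
  kernelProjMatrix G W * (G⁻¹ * F) * kernelProjMatrix G W

theorem hasDerivAt_matrix_of_entries {B : ℝ → Matrix ι ι ℝ} {B' : Matrix ι ι ℝ} {s : ℝ}
    (h : ∀ i j, HasDerivAt (fun r => B r i j) (B' i j) s) : HasDerivAt B B' s := by
  have h1 : HasDerivAt (fun r => ∑ i, ∑ j, B r i j • Matrix.single i j (1 : ℝ))
      (∑ i, ∑ j, B' i j • Matrix.single i j (1 : ℝ)) s :=
    HasDerivAt.fun_sum fun i _ => HasDerivAt.fun_sum fun j _ => (h i j).smul_const _
  have e (A : Matrix ι ι ℝ) : ∑ i, ∑ j, A i j • Matrix.single i j (1 : ℝ) = A := by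
    conv_rhs => rw [Matrix.matrix_eq_sum_single A]
    simp [Matrix.smul_single]
  simpa only [e] using h1

theorem hasDerivAt_matrix_inv {G : ℝ → Matrix ι ι ℝ} {G' : Matrix ι ι ℝ} {s : ℝ}
    (h : HasDerivAt G G' s) (hdet : IsUnit (G s).det) :
    HasDerivAt (fun r => (G r)⁻¹) (-((G s)⁻¹ * G' * (G s)⁻¹)) s := by
  have : CompleteSpace (Matrix ι ι ℝ) := FiniteDimensional.complete ℝ _
  obtain ⟨u, hu⟩ := (Matrix.isUnit_iff_isUnit_det _).2 hdet
  have h1 := hasFDerivAt_ringInverse (𝕜 := ℝ) u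
  rw [hu] at h1
  have h2 := h1.comp_hasDerivAt s h
  have e : (↑u⁻¹ : Matrix ι ι ℝ) = (G s)⁻¹ := by
    rw [← hu, Matrix.coe_units_inv]
  simp only [Function.comp_def, ← Matrix.nonsing_inv_eq_ringInverse, e, neg_apply,
    ContinuousLinearMap.mulLeftRight_apply] at h2
  exact h2

/-- Raising an index with the parallel metric `G` makes a parallel form a parallel endomorphism: the
`Γᵀ` term from the derivative of `G⁻¹` cancels the one from `B`, and a commutator with `Γ` is left.
-/
theorem hasDerivAt_inv_mul_of_formTransport {G B : ℝ → Matrix ι ι ℝ} {Γ : Matrix ι ι ℝ} {s : ℝ}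
    (hG : HasDerivAt G (Γ.transpose * G s + G s * Γ) s)
    (hB : HasDerivAt B (Γ.transpose * B s + B s * Γ) s) (hdet : IsUnit (G s).det) :
    HasDerivAt (fun r => (G r)⁻¹ * B r) ((G s)⁻¹ * B s * Γ - Γ * ((G s)⁻¹ * B s)) s := by
  refine ((hasDerivAt_matrix_inv hG hdet).mul hB).congr_deriv ?_
  have e1 : (G s)⁻¹ * (Γ.transpose * G s + G s * Γ) * (G s)⁻¹
      = (G s)⁻¹ * Γ.transpose + Γ * (G s)⁻¹ := by
    rw [mul_add, add_mul, ← mul_assoc, Matrix.mul_nonsing_inv_cancel_right _ _ hdet,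
      Matrix.nonsing_inv_mul_cancel_left _ _ hdet]
  rw [e1]
  noncomm_ring

theorem hasDerivAt_mul_of_opTransport {X Y : ℝ → Matrix ι ι ℝ} {Γ : Matrix ι ι ℝ} {s : ℝ}
    (hX : HasDerivAt X (X s * Γ - Γ * X s) s) (hY : HasDerivAt Y (Y s * Γ - Γ * Y s) s) :
    HasDerivAt (fun r => X r * Y r) (X s * Y s * Γ - Γ * (X s * Y s)) s :=
  (hX.mul hY).congr_deriv (by noncomm_ring)

/-- The derivative is a commutator, hence traceless. -/
theorem trace_eq_of_opTransport {X Γ : ℝ → Matrix ι ι ℝ}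
    (hX : ∀ s ∈ Set.Icc (0 : ℝ) 1, HasDerivAt X (X s * Γ s - Γ s * X s) s) :
    ∀ s ∈ Set.Icc (0 : ℝ) 1, (X s).trace = (X 0).trace := by
  let tr : Matrix ι ι ℝ →L[ℝ] ℝ := LinearMap.toContinuousLinearMap (Matrix.traceLinearMap ι ℝ ℝ)
  have h (s) (hs : s ∈ Set.Icc (0 : ℝ) 1) : HasDerivAt (fun r => (X r).trace) 0 s := by
    refine (tr.hasFDerivAt.comp_hasDerivAt s (hX s hs)).congr_deriv ?_
    change Matrix.trace _ = 0
    rw [Matrix.trace_sub, Matrix.trace_mul_comm, sub_self]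
  exact constant_of_has_deriv_right_zero
    (fun s hs => (h s hs).continuousAt.continuousWithinAt)
    (fun s hs => (h s ⟨hs.1, hs.2.le⟩).hasDerivWithinAt)

/-- If `G`, `F`, `W` are parallel bilinear forms along a path, written in a moving frame with
connection matrix `Γ`, then the traces of the associated operators do not change. -/
theorem trace_eq_of_formTransport {G F W Γ : ℝ → Matrix ι ι ℝ}
    (hG : ∀ s ∈ Set.Icc (0 : ℝ) 1, ∀ i j,
      HasDerivAt (fun r => G r i j) (((Γ s).transpose * G s + G s * Γ s) i j) s)
    (hF : ∀ s ∈ Set.Icc (0 : ℝ) 1, ∀ i j,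
      HasDerivAt (fun r => F r i j) (((Γ s).transpose * F s + F s * Γ s) i j) s)
    (hW : ∀ s ∈ Set.Icc (0 : ℝ) 1, ∀ i j,
      HasDerivAt (fun r => W r i j) (((Γ s).transpose * W s + W s * Γ s) i j) s)
    (hdet : ∀ s ∈ Set.Icc (0 : ℝ) 1, IsUnit (G s).det) :
    (kernelProjMatrix (G 1) (W 1)).trace = (kernelProjMatrix (G 0) (W 0)).trace ∧
    (compressedMatrix (G 1) (F 1) (W 1) * compressedMatrix (G 1) (F 1) (W 1)).trace
      = (compressedMatrix (G 0) (F 0) (W 0) * compressedMatrix (G 0) (F 0) (W 0)).trace := by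
  have hR (s) (hs : s ∈ Set.Icc (0 : ℝ) 1) := hasDerivAt_inv_mul_of_formTransport
    (hasDerivAt_matrix_of_entries (hG s hs)) (hasDerivAt_matrix_of_entries (hW s hs)) (hdet s hs)
  have hP (s) (hs : s ∈ Set.Icc (0 : ℝ) 1) := hasDerivAt_inv_mul_of_formTransport
    (hasDerivAt_matrix_of_entries (hG s hs)) (hasDerivAt_matrix_of_entries (hF s hs)) (hdet s hs)
  have h1 : (1 : ℝ) ∈ Set.Icc (0 : ℝ) 1 := by simp
  have hc := trace_eq_of_opTransport hR 1 h1
  set c := ((G 0)⁻¹ * W 0).trace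
  -- The normalizing trace in `kernelProjMatrix` does not depend on the parameter, so it can be
  -- frozen at its value `c` at `0`; no quotient has to be differentiated and `c = 0` needs no
  -- separate case.
  have hQ (s) (hs : s ∈ Set.Icc (0 : ℝ) 1) :
      HasDerivAt (fun r => 1 - c⁻¹ • ((G r)⁻¹ * W r))
        ((1 - c⁻¹ • ((G s)⁻¹ * W s)) * Γ s - Γ s * (1 - c⁻¹ • ((G s)⁻¹ * W s))) s := by
    refine (((hR s hs).const_smul c⁻¹).const_sub 1).congr_deriv ?_
    simp only [sub_mul, mul_sub, one_mul, mul_one, smul_sub, smul_mul_assoc, mul_smul_comm]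
    abel
  have hA (s) (hs : s ∈ Set.Icc (0 : ℝ) 1) := hasDerivAt_mul_of_opTransport
    (hasDerivAt_mul_of_opTransport (hQ s hs) (hP s hs)) (hQ s hs)
  have e1 : kernelProjMatrix (G 1) (W 1) = 1 - c⁻¹ • ((G 1)⁻¹ * W 1) := by
    rw [kernelProjMatrix, hc]
  have e0 : kernelProjMatrix (G 0) (W 0) = 1 - c⁻¹ • ((G 0)⁻¹ * W 0) := rfl
  rw [compressedMatrix, compressedMatrix, e1, e0]
  exact ⟨trace_eq_of_opTransport hQ 1 h1,
    trace_eq_of_opTransport (fun s hs => hasDerivAt_mul_of_opTransport (hA s hs) (hA s hs)) 1 h1⟩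

end MatrixTransport

/-! ### Linear algebra of the slant condition at one point -/

section PointwiseAlgebra

open Matrix

variable {V : Type*} [NormedAddCommGroup V] [InnerProductSpace ℝ V] [FiniteDimensional ℝ V]

theorem cos_angleWithSubspace_mul_norm (v : V) (W : Submodule ℝ V) :
    Real.cos (angleWithSubspace v W) * ‖v‖ = ‖W.starProjection v‖ := by
  have h := InnerProductGeometry.cos_angle_mul_norm_mul_norm v (W.starProjection v)
  have h2 : inner ℝ v (W.starProjection v) = ‖W.starProjection v‖ ^ 2 := by
    rw [← real_inner_self_eq_norm_sq,
      W.inner_starProjection_left_eq_right v (W.starProjection v),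
      Submodule.starProjection_eq_self_iff.2 (Submodule.starProjection_apply_mem _ _)]
  rw [h2] at h
  by_cases h0 : ‖W.starProjection v‖ = 0
  · rw [angleWithSubspace, norm_eq_zero.1 h0]
    simp
  · refine mul_right_cancel₀ h0 ?_
    rw [angleWithSubspace, mul_assoc, h, sq]

theorem cos_angleWithSubspace_nonneg (v : V) (W : Submodule ℝ V) :
    0 ≤ Real.cos (angleWithSubspace v W) := by
  by_cases hv : v = 0
  · simp [angleWithSubspace, hv]
  · refine nonneg_of_mul_nonneg_left ?_ (norm_pos_iff.2 hv)
    rw [cos_angleWithSubspace_mul_norm]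
    exact norm_nonneg _

/-- If a skew endomorphism followed by the projection to `K` scales norms on `K` by `c`, then its
compression to `K` squares to `-c²`. -/
theorem starProjection_skew_sq {K : Submodule ℝ V} {φ : V →ₗ[ℝ] V}
    (φ_skew : ∀ v w, inner ℝ (φ v) w = -(inner ℝ v (φ w) : ℝ)) {c : ℝ}
    (h : ∀ x ∈ K, ‖K.starProjection (φ x)‖ = c * ‖x‖) {x : V} (hx : x ∈ K) :
    K.starProjection (φ (K.starProjection (φ x))) = -c ^ 2 • x := by
  set B : V →ₗ[ℝ] V := K.starProjection.toLinearMap ∘ₗ φ with hB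
  have mem (v) : B v ∈ K := Submodule.starProjection_apply_mem _ _
  have sq (x) (hx : x ∈ K) : inner ℝ (B x) (B x) = c ^ 2 * (inner ℝ x x : ℝ) := by
    rw [real_inner_self_eq_norm_sq, real_inner_self_eq_norm_sq, show ‖B x‖ = c * ‖x‖ from h x hx,
      mul_pow]
  have pol (x y) (hx : x ∈ K) (hy : y ∈ K) :
      inner ℝ (B x) (B y) = c ^ 2 * (inner ℝ x y : ℝ) := by
    have h1 := sq _ (K.add_mem hx hy)
    rw [map_add, real_inner_add_add_self, real_inner_add_add_self, sq x hx, sq y hy] at h1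
    linarith
  have proj (v y) (hy : y ∈ K) : inner ℝ (K.starProjection v) y = (inner ℝ v y : ℝ) := by
    rw [Submodule.inner_starProjection_left_eq_right, Submodule.starProjection_eq_self_iff.2 hy]
  have skew (x y) (hx : x ∈ K) (hy : y ∈ K) : inner ℝ (B x) y = -(inner ℝ x (B y) : ℝ) := by
    rw [real_inner_comm (B y) x]
    change inner ℝ (K.starProjection (φ x)) y = -(inner ℝ (K.starProjection (φ y)) x : ℝ)
    rw [proj _ _ hy, proj _ _ hx, φ_skew, real_inner_comm]
  change B (B x) = _
  -- This vector lies in `K` and is orthogonal to `K`, because `⟨B²x, y⟩ = -⟨Bx, By⟩ = -c²⟨x, y⟩` by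
  -- skewness and polarization.
  have hm : B (B x) + c ^ 2 • x ∈ K := K.add_mem (mem _) (K.smul_mem _ hx)
  have h0 (y) (hy : y ∈ K) : inner ℝ (B (B x) + c ^ 2 • x) y = (0 : ℝ) := by
    rw [inner_add_left, skew _ _ (mem _) hy, pol _ _ hx hy, inner_smul_left]
    simp
  rw [neg_smul, ← add_eq_zero_iff_eq_neg]
  exact inner_self_eq_zero.1 (h0 _ hm)

variable {ι : Type*} [Fintype ι] [DecidableEq ι]

/-- The matrix of the bilinear form `(v, w) ↦ ⟨v, L w⟩` in the family `b`. -/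
def formMatrix (b : ι → V) (L : V → V) : Matrix ι ι ℝ := .of fun i j => inner ℝ (b i) (L (b j))

theorem dotProduct_formMatrix_mulVec (b : ι → V) (L : V →ₗ[ℝ] V) (v w : ι → ℝ) :
    v ⬝ᵥ formMatrix b L *ᵥ w
      = inner ℝ (Fintype.linearCombination ℝ b v) (L (Fintype.linearCombination ℝ b w)) := by
  simp only [Fintype.linearCombination_apply, map_sum, map_smul, sum_inner, inner_sum,
    inner_smul_left, inner_smul_right, dotProduct, mulVec, formMatrix, of_apply, Finset.mul_sum]
  rw [Finset.sum_comm]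
  refine Finset.sum_congr rfl fun i _ => Finset.sum_congr rfl fun j _ => ?_
  simp; ring

theorem isUnit_det_formMatrix {b : ι → V} (hb : LinearIndependent ℝ b) :
    IsUnit (formMatrix b id).det :=
  isUnit_iff_ne_zero.2 (det_gram_ne_zero_iff_linearIndependent.2 hb)

/-- Riesz representation in the span of `b`: the inverse Gram matrix takes the components of a
functional to the coordinates of the vector representing it. -/
theorem inner_linearCombination_inv_mulVec {b : ι → V} (hb : LinearIndependent ℝ b)
    (v w : ι → ℝ) :
    inner ℝ (Fintype.linearCombination ℝ b v)
      (Fintype.linearCombination ℝ b ((formMatrix b id)⁻¹ *ᵥ w)) = v ⬝ᵥ w := by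
  have h := dotProduct_formMatrix_mulVec b LinearMap.id v ((formMatrix b id)⁻¹ *ᵥ w)
  rw [LinearMap.id_coe, mulVec_mulVec, mul_nonsing_inv _ (isUnit_det_formMatrix hb),
    one_mulVec] at h
  exact h.symm

section

variable {b : ι → V} {ξ : V} {W : Matrix ι ι ℝ}

/-- The vector `s = G⁻¹t` holds the coordinates of the component of `ξ` in the span of `b`. Thus
`G⁻¹W = s ⊗ t` is the squared length of that component times the projection onto its line, and its
trace is that squared length; normalizing and subtracting from `1` projects onto the complement. -/
theorem linearCombination_kernelProjMatrix (hb : LinearIndependent ℝ b)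
    (hW : W = vecMulVec (fun i => inner ℝ (b i) ξ) (fun i => inner ℝ (b i) ξ))
    {K : Submodule ℝ V}
    (hK : K = LinearMap.range (Fintype.linearCombination ℝ b) ⊓ (Submodule.span ℝ {ξ})ᗮ)
    (a : ι → ℝ) :
    Fintype.linearCombination ℝ b (kernelProjMatrix (formMatrix b id) W *ᵥ a)
      = K.starProjection (Fintype.linearCombination ℝ b a) := by
  subst hK
  set C := Fintype.linearCombination ℝ b with hC
  set t : ι → ℝ := fun i => inner ℝ (b i) ξ with ht
  set s : ι → ℝ := (formMatrix b id)⁻¹ *ᵥ t with hs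
  have ht_inner (v) : inner ℝ (C v) ξ = v ⬝ᵥ t := by
    simp [hC, Fintype.linearCombination_apply, sum_inner, inner_smul_left, dotProduct, ht]
  have hs_inner (v) : inner ℝ (C v) (C s) = v ⬝ᵥ t := inner_linearCombination_inv_mulVec hb v t
  have hR : (formMatrix b id)⁻¹ * W = vecMulVec s t := by
    rw [hW, mul_vecMulVec]
  set c := s ⬝ᵥ t with hc
  have hQ : kernelProjMatrix (formMatrix b id) W *ᵥ a = a - (c⁻¹ * (a ⬝ᵥ t)) • s := by
    rw [kernelProjMatrix, hR, trace_vecMulVec, sub_mulVec, one_mulVec, smul_mulVec,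
      vecMulVec_mulVec, mul_smul, dotProduct_comm t a]
    congr 2
    exact op_smul_eq_smul _ _
  -- Here `c = ‖C s‖²`. If it vanishes, `ξ` is orthogonal to the whole span, and the convention `0⁻¹
  -- = 0` makes the matrix the identity, as it should be.
  have hct : c = 0 → t = 0 := by
    intro h0
    have h1 : C s = 0 := inner_self_eq_zero.1 ((hs_inner s).trans h0)
    refine funext fun i => ?_
    have := hs_inner (Pi.single i 1)
    rw [h1, inner_zero_right, single_dotProduct, one_mul] at this
    exact this.symm
  symm
  refine Submodule.eq_starProjection_of_mem_of_inner_eq_zero ?_ ?_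
  · refine ⟨⟨_, rfl⟩, ?_⟩
    rw [SetLike.mem_coe, Submodule.mem_orthogonal_singleton_iff_inner_left, ht_inner, hQ,
      sub_dotProduct, smul_dotProduct, ← hc, smul_eq_mul]
    by_cases h0 : c = 0
    · simp [hct h0]
    · field_simp
      ring
  · rintro w ⟨⟨w, rfl⟩, hw⟩
    rw [SetLike.mem_coe, Submodule.mem_orthogonal_singleton_iff_inner_left, ht_inner] at hw
    rw [hQ, map_sub, sub_sub_cancel, map_smul, inner_smul_left, real_inner_comm, hs_inner, hw,
      mul_zero]

/-- `G⁻¹F` represents `φ` followed by projection to the span of `b`. The component lost is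
orthogonal to `K`, which lies in the span, so the final projection to `K` does not see it. -/
theorem linearCombination_compressedMatrix (hb : LinearIndependent ℝ b)
    (hW : W = vecMulVec (fun i => inner ℝ (b i) ξ) (fun i => inner ℝ (b i) ξ))
    (φ : V →ₗ[ℝ] V) {K : Submodule ℝ V}
    (hK : K = LinearMap.range (Fintype.linearCombination ℝ b) ⊓ (Submodule.span ℝ {ξ})ᗮ)
    (a : ι → ℝ) :
    Fintype.linearCombination ℝ b
        (compressedMatrix (formMatrix b id) (formMatrix b φ) W *ᵥ a)
      = K.starProjection (φ (K.starProjection (Fintype.linearCombination ℝ b a))) := by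
  rw [compressedMatrix, mul_assoc, ← mulVec_mulVec, linearCombination_kernelProjMatrix hb hW hK,
    ← mulVec_mulVec, ← sub_eq_zero, ← map_sub, Submodule.starProjection_apply_eq_zero_iff,
    ← linearCombination_kernelProjMatrix hb hW hK, Submodule.mem_orthogonal]
  intro w hw
  rw [hK] at hw
  obtain ⟨⟨w, rfl⟩, -⟩ := hw
  rw [inner_sub_right, ← mulVec_mulVec, inner_linearCombination_inv_mulVec hb,
    dotProduct_formMatrix_mulVec, sub_self]

/-- The matrix is idempotent with image the coordinates of `K`, so its trace is the dimension of
`K`. -/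
theorem trace_kernelProjMatrix_eq_zero_iff (hb : LinearIndependent ℝ b)
    (hW : W = vecMulVec (fun i => inner ℝ (b i) ξ) (fun i => inner ℝ (b i) ξ))
    {K : Submodule ℝ V}
    (hK : K = LinearMap.range (Fintype.linearCombination ℝ b) ⊓ (Submodule.span ℝ {ξ})ᗮ) :
    (kernelProjMatrix (formMatrix b id) W).trace = 0 ↔ K = ⊥ := by
  set Q := kernelProjMatrix (formMatrix b id) W with hQ
  have key := linearCombination_kernelProjMatrix hb hW hK
  rw [← hQ] at key
  have inj : Function.Injective (Fintype.linearCombination ℝ b) :=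
    linearIndependent_iff_injective_fintypeLinearCombination.1 hb
  have hQQ : IsIdempotentElem (toLin' Q) := by
    refine LinearMap.ext fun a => inj ?_
    rw [Module.End.mul_apply, toLin'_apply, toLin'_apply, key, key]
    exact Submodule.starProjection_eq_self_iff.2 (Submodule.starProjection_apply_mem _ _)
  have htr := LinearMap.IsIdempotentElem.trace_eq_zero_iff hQQ
  rw [trace_toLin'_eq] at htr
  rw [htr]
  constructor
  · intro h0
    refine (Submodule.eq_bot_iff _).2 fun x hx => ?_
    obtain ⟨a, rfl⟩ : x ∈ LinearMap.range (Fintype.linearCombination ℝ b) := (hK ▸ hx).1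
    have h1 := key a
    rw [← toLin'_apply, h0, LinearMap.zero_apply, map_zero,
      Submodule.starProjection_eq_self_iff.2 hx] at h1
    exact h1.symm
  · intro h0
    refine LinearMap.ext fun a => inj ?_
    rw [toLin'_apply, key, LinearMap.zero_apply, map_zero]
    have h1 : K.starProjection (Fintype.linearCombination ℝ b a) ∈ K :=
      Submodule.starProjection_apply_mem _ _
    exact (Submodule.eq_bot_iff _).1 h0 _ h1

/-- The slant condition gives `‖Pφx‖ = cos θ ‖x‖` on `K`, since `φ` preserves norms there; then
`starProjection_skew_sq` makes the square of the compression `-cos²θ` times the projection. -/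
theorem trace_compressedMatrix_sq (hb : LinearIndependent ℝ b)
    (hW : W = vecMulVec (fun i => inner ℝ (b i) ξ) (fun i => inner ℝ (b i) ξ))
    {φ : V →ₗ[ℝ] V} (φ_skew : ∀ v w, inner ℝ (φ v) w = -(inner ℝ v (φ w) : ℝ))
    (φ_norm : ∀ v, inner ℝ v ξ = (0 : ℝ) → ‖φ v‖ = ‖v‖) {K : Submodule ℝ V}
    (hK : K = LinearMap.range (Fintype.linearCombination ℝ b) ⊓ (Submodule.span ℝ {ξ})ᗮ)
    {θ : ℝ} (hθ : ∀ x ∈ K, x ≠ 0 → angleWithSubspace (φ x) K = θ) :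
    (compressedMatrix (formMatrix b id) (formMatrix b φ) W
      * compressedMatrix (formMatrix b id) (formMatrix b φ) W).trace
      = -Real.cos θ ^ 2 * (kernelProjMatrix (formMatrix b id) W).trace := by
  have inj : Function.Injective (Fintype.linearCombination ℝ b) :=
    linearIndependent_iff_injective_fintypeLinearCombination.1 hb
  have scale : ∀ x ∈ K, ‖K.starProjection (φ x)‖ = Real.cos θ * ‖x‖ := by
    intro x hx
    by_cases h0 : x = 0
    · simp [h0]
    · have hx2 := hx
      rw [hK] at hx2
      rw [← cos_angleWithSubspace_mul_norm, hθ x hx h0, φ_norm x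
        (Submodule.mem_orthogonal_singleton_iff_inner_left.1 hx2.2)]
  have h : compressedMatrix (formMatrix b id) (formMatrix b φ) W
      * compressedMatrix (formMatrix b id) (formMatrix b φ) W
      = -Real.cos θ ^ 2 • kernelProjMatrix (formMatrix b id) W := by
    refine ext_iff_mulVec.2 fun a => inj ?_
    rw [← mulVec_mulVec, linearCombination_compressedMatrix hb hW φ hK,
      linearCombination_compressedMatrix hb hW φ hK, smul_mulVec, map_smul,
      linearCombination_kernelProjMatrix hb hW hK,
      Submodule.starProjection_eq_self_iff.2 (Submodule.starProjection_apply_mem _ (φ _)),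
      starProjection_skew_sq φ_skew scale (Submodule.starProjection_apply_mem _ _)]
  rw [h, trace_smul, smul_eq_mul]

end

end PointwiseAlgebra

/-! ### The algebra behind `∇φ = 0` -/

section Algebra

variable {V : Type*} [NormedAddCommGroup V] [InnerProductSpace ℝ V]

/-- Pointwise part of "a cosymplectic structure has parallel `φ`": `D` stands for `∇φ` and `z` for
`∇ξ`. -/
theorem eq_zero_of_cosymplectic_identities (φ : V →ₗ[ℝ] V) (ξ : V) (D : V →ₗ[ℝ] V →ₗ[ℝ] V)
    (z : V →ₗ[ℝ] V) (φ_ξ : φ ξ = 0)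
    (φ_sq : ∀ v, φ (φ v) = -v + (inner ℝ ξ v : ℝ) • ξ)
    (φ_skew : ∀ v w, inner ℝ (φ v) w = -(inner ℝ v (φ w) : ℝ))
    (D_skew : ∀ u v w, inner ℝ (D u v) w = -(inner ℝ v (D u w) : ℝ))
    (D_φ : ∀ u v, φ (D u v) + D u (φ v) = (inner ℝ (z u) v : ℝ) • ξ + (inner ℝ ξ v : ℝ) • z u)
    (D_ξ : ∀ u, D u ξ = -φ (z u)) (z_ξ : ∀ u, inner ℝ (z u) ξ = (0 : ℝ))
    (closed_η : ∀ u v, inner ℝ (z u) v = (inner ℝ (z v) u : ℝ))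
    (closed_Φ : ∀ u v w,
      inner ℝ (D u v) w + inner ℝ (D v w) u + inner ℝ (D w u) v = (0 : ℝ))
    (normal : ∀ u v, D (φ u) v - D (φ v) u - φ (D u v) + φ (D v u) = 0) :
    D = 0 := by
  have zero_of (v : V) (h : φ v = 0) (h' : inner ℝ v ξ = (0 : ℝ)) : v = 0 := by
    have := φ_sq v
    rw [h, map_zero, real_inner_comm, h', zero_smul, add_zero] at this
    exact neg_eq_zero.1 this.symm
  -- Closedness of `Φ` with `ξ` as one argument.
  have Dξ (x) : D ξ x = -φ (z x) - z (φ x) := by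
    refine ext_inner_right ℝ fun y => ?_
    have h1 := closed_Φ ξ x y
    rw [D_skew x y ξ, D_ξ, D_ξ y, inner_neg_right, inner_neg_left, φ_skew (z y) x,
      closed_η y (φ x), real_inner_comm] at h1
    rw [inner_sub_left, inner_neg_left]
    linarith [real_inner_comm (φ (z x)) y, real_inner_comm (D ξ x) y]
  -- Normality at `(x, ξ)` reduces to `-2 φ(z(φ x)) = 0`, and `φ` is injective on the complement of
  -- `ξ`.
  have zφ (x) : z (φ x) = 0 := by
    have h1 := normal x ξ
    rw [φ_ξ, map_zero, D_ξ, D_ξ, Dξ] at h1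
    simp only [LinearMap.zero_apply, map_neg, map_sub] at h1
    refine zero_of _ ?_ (z_ξ _)
    have h2 : (2 : ℝ) • φ (z (φ x)) = 0 := by
      rw [two_smul, ← neg_eq_zero, ← h1]; abel
    simpa using h2
  have zξ : z ξ = 0 := by
    have h (x) : inner ℝ (z ξ) (φ x) = (0 : ℝ) := by
      rw [closed_η, zφ, inner_zero_left]
    refine zero_of _ ?_ (z_ξ _)
    refine ext_inner_right ℝ fun y => ?_
    rw [φ_skew, h, neg_zero, inner_zero_left]
  -- `z` kills the image of `φ` and `ξ`, which span by the formula for `φ²`. So `∇ξ = 0`, and `D`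
  -- anticommutes with `φ`.
  have z0 (x) : z x = 0 := by
    have h := congrArg z (φ_sq x)
    rw [zφ, map_add, map_neg, map_smul, zξ, smul_zero, add_zero] at h
    exact neg_eq_zero.1 h.symm
  have D0 (u v) : φ (D u v) = -D u (φ v) := by
    have := D_φ u v
    rw [z0, inner_zero_left, zero_smul, smul_zero, add_zero] at this
    exact eq_neg_of_add_eq_zero_left this
  have Duξ (u) : D u ξ = 0 := by rw [D_ξ, z0, map_zero, neg_zero]
  set T : V → V → V → ℝ := fun x y w => inner ℝ (D x y) w with hT
  have Tskew (x y w) : T x y w = -T x w y := by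
    simp only [hT]; rw [D_skew, real_inner_comm]
  have Tφ (x y w) : T x y (φ w) = T x (φ y) w := by
    simp only [hT]
    have := φ_skew (D x y) w
    rw [D0, inner_neg_left] at this
    linarith
  have hb (x y w) : T x (φ y) w = -T x (φ w) y := by rw [Tskew, Tφ]
  have hN (x y w) : T (φ x) y w - T (φ y) x w + T x (φ y) w - T y (φ x) w = 0 := by
    have := congrArg (fun v => (inner ℝ v w : ℝ)) (normal x y)
    simp only [D0, inner_add_left, inner_sub_left, inner_neg_left, inner_zero_left] at this
    simp only [hT]
    linarith
  -- By `hN` the sum `T (φ x) y w + T x (φ y) w` is symmetric in `x, y`; it is also skew in `y, w`.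
  -- A trilinear form with both symmetries vanishes.
  have hc (x y w) : T (φ x) y w = -T x (φ y) w := by
    linarith [hN x y w, hN y w x, hN w x y, hb x y w, hb y w x, hb w x y, hb x w y, hb y x w,
      hb w y x, Tskew (φ x) y w, Tskew (φ y) w x, Tskew (φ w) x y]
  have hS (x y w) : T x y w + T y w x + T w x y = 0 := closed_Φ x y w
  -- Apply the cyclic identity to `(x, y, φ w)` and to `(φ x, y, w)`, and move every `φ` to the
  -- middle slot: the sum of the two is `2 T y (φ w) x = 0`.
  have b0 (y w x) : T y (φ w) x = 0 := by
    linarith [hS x y (φ w), hS (φ x) y w, Tφ x y w, hc w x y, hc x y w, Tφ y w x, hb x y w,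
      hb y w x, hb w x y]
  refine LinearMap.ext fun x => LinearMap.ext fun y => ext_inner_right ℝ fun w => ?_
  have h := b0 x (φ y) w
  simp only [hT, φ_sq, map_add, map_neg, map_smul, Duξ, smul_zero, add_zero, inner_neg_left] at h
  simpa using h

end Algebra

/-! ### Parallelism of `φ` on a cosymplectic manifold -/

namespace AlmostContactMetricStructure

variable {E : Type*} [NormedAddCommGroup E] [NormedSpace ℝ E]
  {H : Type*} [TopologicalSpace H] {I : ModelWithCorners ℝ E H}
  {N : Type*} [TopologicalSpace N] [ChartedSpace H N] [IsManifold I ∞ N]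
  [RiemannianBundle (fun x : N => TangentSpace I x)]
  (S : AlmostContactMetricStructure I N)

theorem φ_ξ (x : N) : S.φ x (S.ξ x) = 0 := by
  have h1 : S.φ x (S.φ x (S.ξ x)) = 0 := by rw [S.φ_sq, S.η_ξ, one_smul, neg_add_cancel]
  have h2 := S.φ_sq x (S.φ x (S.ξ x))
  rw [h1, map_zero] at h2
  have h3 : S.φ x (S.ξ x) = S.η x (S.φ x (S.ξ x)) • S.ξ x :=
    (neg_add_eq_zero.1 h2.symm)
  have h4 := congrArg (S.φ x) h3
  rw [h1, map_smul] at h4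
  rcases smul_eq_zero.1 h4.symm with h | h
  · rw [h3, h, zero_smul]
  · exact h

theorem η_eq_inner (x : N) (v : TangentSpace I x) : S.η x v = inner ℝ (S.ξ x) v := by
  have h := S.inner_φ_φ x (S.ξ x) v
  rw [S.φ_ξ, inner_zero_left, S.η_ξ, one_mul] at h
  linarith

theorem η_φ (x : N) (v : TangentSpace I x) : S.η x (S.φ x v) = 0 := by
  have h1 := congrArg (S.φ x) (S.φ_sq x v)
  rw [S.φ_sq x (S.φ x v), map_add, map_smul, S.φ_ξ, smul_zero, map_neg, add_right_inj] at h1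
  simpa [S.η_ξ] using congrArg (S.η x) h1

theorem inner_φ_left (x : N) (v w : TangentSpace I x) :
    inner ℝ (S.φ x v) w = -(inner ℝ v (S.φ x w) : ℝ) := by
  have h := S.inner_φ_φ x v (S.φ x w)
  rw [S.φ_sq, inner_add_right, inner_neg_right, inner_smul_right, real_inner_comm (S.ξ x),
    ← S.η_eq_inner, S.η_φ, S.η_φ] at h
  linarith

theorem mdiffAt_φ_apply {Y : Π x : N, TangentSpace I x} {x : N} (hY : MDiffAt (T% Y) x) :
    MDiffAt (T% (fun y => S.φ y (Y y))) x :=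
  MDifferentiableAt.clm_bundle_apply (F₁ := E) (F₂ := E) (E₁ := fun x : N => TangentSpace I x)
    (E₂ := fun x : N => TangentSpace I x)
    (S.contMDiff_φ.contMDiffAt.mdifferentiableAt (by simp)) hY

theorem mdiffAt_ξ (x : N) : MDiffAt (T% S.ξ) x :=
  S.contMDiff_ξ.contMDiffAt.mdifferentiableAt (by simp)

variable [FiniteDimensional ℝ E]
  [IsContMDiffRiemannianBundle I ∞ E (fun x : N => TangentSpace I x)]

theorem mdiffAt_η_apply {Y : Π x : N, TangentSpace I x} {x : N} (hY : MDiffAt (T% Y) x) :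
    MDiffAt (fun y => S.η y (Y y)) x := by
  simp only [S.η_eq_inner]
  exact mdiffAt_inner (S.mdiffAt_ξ x) hY

/-- The two terms containing the derivative of a scalar factor cancel because `φ` is linear on
fibres. -/
theorem tensorialAt_nabla_φ (x : N) :
    TensorialAt I E (fun Y : Π x : N, TangentSpace I x =>
      leviCivita (fun y => S.φ y (Y y)) x - S.φ x ∘L leviCivita Y x) x where
  smul {f Y} hf hY := by
    have e : (fun y => S.φ y ((f • Y) y)) = f • fun y => S.φ y (Y y) := by
      ext y; simp
    have h1 := (leviCivita (I := I) (N := N)).isCovariantDerivativeOnUniv.leibniz hY hf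
    have h2 := (leviCivita (I := I) (N := N)).isCovariantDerivativeOnUniv.leibniz
      (S.mdiffAt_φ_apply hY) hf
    rw [e]
    erw [h1, h2]
    ext v
    simp [smul_sub]
  add {Y Y'} hY hY' := by
    have e : (fun y => S.φ y ((Y + Y') y)) = (fun y => S.φ y (Y y)) + fun y => S.φ y (Y' y) := by
      ext y; simp
    have h1 := (leviCivita (I := I) (N := N)).isCovariantDerivativeOnUniv.add hY hY'
    have h2 := (leviCivita (I := I) (N := N)).isCovariantDerivativeOnUniv.add
      (S.mdiffAt_φ_apply hY) (S.mdiffAt_φ_apply hY')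
    rw [e]
    erw [h1, h2]
    ext v
    simp
    abel

/-- The covariant derivative `(u, v) ↦ (∇_u φ) v`. -/
noncomputable def nablaφ (x : N) :
    TangentSpace I x →ₗ[ℝ] TangentSpace I x →ₗ[ℝ] TangentSpace I x :=
  LinearMap.flip ((ContinuousLinearMap.coeLM ℝ).comp
    (TensorialAt.mkHom _ x (S.tensorialAt_nabla_φ x)).toLinearMap)

theorem nablaφ_apply {Y : Π x : N, TangentSpace I x} {x : N} (hY : MDiffAt (T% Y) x)
    (u : TangentSpace I x) :
    S.nablaφ x u (Y x) = leviCivita (fun y => S.φ y (Y y)) x u - S.φ x (leviCivita Y x u) := by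
  have h := TensorialAt.mkHom_apply (S.tensorialAt_nabla_φ x) hY
  have h2 := congrArg (fun A : TangentSpace I x →L[ℝ] TangentSpace I x => A u) h
  exact h2

theorem nablaφ_extend {x : N} (u v : TangentSpace I x) :
    S.nablaφ x u v = leviCivita (fun y => S.φ y (FiberBundle.extend E v y)) x u
      - S.φ x (leviCivita (FiberBundle.extend E v) x u) := by
  simpa using S.nablaφ_apply (FiberBundle.mdifferentiableAt_extend I E v) u

end AlmostContactMetricStructure

section

variable {E : Type*} [NormedAddCommGroup E] [NormedSpace ℝ E] [FiniteDimensional ℝ E]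
  {H : Type*} [TopologicalSpace H] {I : ModelWithCorners ℝ E H}
  {N : Type*} [TopologicalSpace N] [ChartedSpace H N] [IsManifold I ∞ N]
  [RiemannianBundle (fun x : N => TangentSpace I x)]
  [IsContMDiffRiemannianBundle I ∞ E (fun x : N => TangentSpace I x)]

/-- Compatibility of the Levi-Civita connection with the metric, for a single tangent vector. -/
theorem leviCivita_metric_apply {Y Z : Π x : N, TangentSpace I x} {x : N}
    (hY : MDiffAt (T% Y) x) (hZ : MDiffAt (T% Z) x) (u : TangentSpace I x) :
    mvfderiv I (fun y => inner ℝ (Y y) (Z y)) x u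
      = inner ℝ (leviCivita Y x u) (Z x) + inner ℝ (Y x) (leviCivita Z x u) := by
  simpa using leviCivita_metric (FiberBundle.mdifferentiableAt_extend I E u) hY hZ

end

namespace AlmostContactMetricStructure

variable {E : Type*} [NormedAddCommGroup E] [NormedSpace ℝ E] [FiniteDimensional ℝ E]
  {H : Type*} [TopologicalSpace H] {I : ModelWithCorners ℝ E H}
  {N : Type*} [TopologicalSpace N] [ChartedSpace H N] [IsManifold I ∞ N]
  [RiemannianBundle (fun x : N => TangentSpace I x)]
  [IsContMDiffRiemannianBundle I ∞ E (fun x : N => TangentSpace I x)]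
  (S : AlmostContactMetricStructure I N)

theorem inner_nablaφ_left (x : N) (u v w : TangentSpace I x) :
    inner ℝ (S.nablaφ x u v) w = -(inner ℝ v (S.nablaφ x u w) : ℝ) := by
  have hV := FiberBundle.mdifferentiableAt_extend I E v
  have hW := FiberBundle.mdifferentiableAt_extend I E w
  have h1 := leviCivita_metric_apply (S.mdiffAt_φ_apply hV) hW u
  have h2 := leviCivita_metric_apply hV (S.mdiffAt_φ_apply hW) u
  simp only [S.inner_φ_left] at h1
  rw [show (fun y => -(inner ℝ (FiberBundle.extend E v y) (S.φ y (FiberBundle.extend E w y)) : ℝ))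
    = -(fun y => (inner ℝ (FiberBundle.extend E v y) (S.φ y (FiberBundle.extend E w y)) : ℝ))
    from rfl, mvfderiv_neg, neg_apply, h2] at h1
  simp only [FiberBundle.extend_apply_self] at h1
  rw [S.nablaφ_extend, S.nablaφ_extend, inner_sub_left, inner_sub_right, S.inner_φ_left]
  have h3 := S.inner_φ_left x v (leviCivita (FiberBundle.extend E w) x u)
  linarith

theorem mvfderiv_η_apply {Y : Π x : N, TangentSpace I x} {x : N} (hY : MDiffAt (T% Y) x)
    (u : TangentSpace I x) :
    mvfderiv I (fun y => S.η y (Y y)) x u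
      = inner ℝ (leviCivita S.ξ x u) (Y x) + inner ℝ (S.ξ x) (leviCivita Y x u) := by
  simp only [S.η_eq_inner]
  exact leviCivita_metric_apply (S.mdiffAt_ξ x) hY u

/-- The covariant derivative of `φ² + 1 = η ⊗ ξ`. -/
theorem φ_nablaφ_add (x : N) (u v : TangentSpace I x) :
    S.φ x (S.nablaφ x u v) + S.nablaφ x u (S.φ x v)
      = (inner ℝ (leviCivita S.ξ x u) v : ℝ) • S.ξ x
        + (inner ℝ (S.ξ x) v : ℝ) • leviCivita S.ξ x u := by
  have hV := FiberBundle.mdifferentiableAt_extend I E v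
  have h1 := S.nablaφ_apply (S.mdiffAt_φ_apply hV) u
  set V := FiberBundle.extend E v with hVdef
  have hv : V x = v := by simp [V]
  have e : (fun y => S.φ y (S.φ y (V y))) + V = (fun y => S.η y (V y)) • S.ξ := by
    ext y; simp [S.φ_sq]
  have h2 := (leviCivita (I := I) (N := N)).isCovariantDerivativeOnUniv.add
    (S.mdiffAt_φ_apply (S.mdiffAt_φ_apply hV)) hV
  have h3 := (leviCivita (I := I) (N := N)).isCovariantDerivativeOnUniv.leibniz
    (S.mdiffAt_ξ x) (S.mdiffAt_η_apply hV)
  rw [e] at h2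
  rw [h3] at h2
  have h4 := congrArg (fun A : TangentSpace I x →L[ℝ] TangentSpace I x => A u) h2
  have h5 := S.mvfderiv_η_apply hV u
  have h6 : S.η x (V x) • leviCivita S.ξ x u + mvfderiv I (fun y => S.η y (V y)) x u • S.ξ x
      = leviCivita (fun y => S.φ y (S.φ y (V y))) x u + leviCivita V x u := h4
  rw [h5, S.η_eq_inner] at h6
  have h7 := S.nablaφ_apply hV u
  rw [hv] at h1 h6 h7
  rw [h1, h7, map_sub, S.φ_sq, S.η_eq_inner, add_smul] at *
  rw [← sub_eq_zero] at h6 ⊢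
  rw [← neg_eq_zero, ← h6]
  abel

theorem nablaφ_ξ (x : N) (u : TangentSpace I x) :
    S.nablaφ x u (S.ξ x) = -S.φ x (leviCivita S.ξ x u) := by
  rw [S.nablaφ_apply (S.mdiffAt_ξ x) u]
  have e : (fun y => S.φ y (S.ξ y)) = 0 := by ext y; simp [S.φ_ξ]
  rw [e, CovariantDerivative.zero]
  simp

theorem inner_nablaξ_ξ (x : N) (u : TangentSpace I x) :
    inner ℝ (leviCivita S.ξ x u) (S.ξ x) = (0 : ℝ) := by
  have h := S.mvfderiv_η_apply (S.mdiffAt_ξ x) u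
  simp only [S.η_ξ, mvfderiv_const] at h
  rw [real_inner_comm (leviCivita S.ξ x u) (S.ξ x)] at h
  simp at h
  linarith

variable {S}

theorem IsCosymplectic.inner_nablaξ_comm (hS : S.IsCosymplectic) (x : N)
    (u v : TangentSpace I x) :
    inner ℝ (leviCivita S.ξ x u) v = (inner ℝ (leviCivita S.ξ x v) u : ℝ) := by
  have hU := FiberBundle.mdifferentiableAt_extend I E u
  have hV := FiberBundle.mdifferentiableAt_extend I E v
  have h := hS.1.1 x _ _ (FiberBundle.contMDiffAt_extend I E u)
    (FiberBundle.contMDiffAt_extend I E v)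
  rw [extDerivOneForm, S.mvfderiv_η_apply hU, S.mvfderiv_η_apply hV, ← leviCivita_torsion hU hV,
    S.η_eq_inner, inner_sub_right] at h
  simp only [FiberBundle.extend_apply_self] at h
  linarith

/-- `dΦ = 0` with brackets rewritten through the torsion-free connection; only derivatives of `φ`
survive. -/
theorem IsCosymplectic.cyclic_nablaφ (hS : S.IsCosymplectic) (x : N)
    (u v w : TangentSpace I x) :
    inner ℝ (S.nablaφ x u v) w + inner ℝ (S.nablaφ x v w) u + inner ℝ (S.nablaφ x w u) v
      = (0 : ℝ) := by
  have hU := FiberBundle.mdifferentiableAt_extend I E u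
  have hV := FiberBundle.mdifferentiableAt_extend I E v
  have hW := FiberBundle.mdifferentiableAt_extend I E w
  have h := hS.1.2 x _ _ _ (FiberBundle.contMDiffAt_extend I E u)
    (FiberBundle.contMDiffAt_extend I E v) (FiberBundle.contMDiffAt_extend I E w)
  simp only [extDerivTwoForm, fundamentalForm] at h
  rw [leviCivita_metric_apply hU (S.mdiffAt_φ_apply hV),
    leviCivita_metric_apply hV (S.mdiffAt_φ_apply hW),
    leviCivita_metric_apply hW (S.mdiffAt_φ_apply hU),
    ← leviCivita_torsion hU hV, ← leviCivita_torsion hV hW, ← leviCivita_torsion hW hU] at h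
  simp only [FiberBundle.extend_apply_self, inner_sub_left] at h
  rw [S.inner_nablaφ_left, S.inner_nablaφ_left x v, S.inner_nablaφ_left x w]
  simp only [S.nablaφ_extend, inner_sub_right]
  have s (a b : TangentSpace I x) : inner ℝ a (S.φ x b) = -(inner ℝ b (S.φ x a) : ℝ) := by
    rw [real_inner_comm, S.inner_φ_left]
  rw [s u, s v, s w]
  linarith

theorem IsCosymplectic.nijenhuis_nablaφ (hS : S.IsCosymplectic) (x : N)
    (u v : TangentSpace I x) :
    S.nablaφ x (S.φ x u) v - S.nablaφ x (S.φ x v) u - S.φ x (S.nablaφ x u v)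
      + S.φ x (S.nablaφ x v u) = 0 := by
  have hU := FiberBundle.mdifferentiableAt_extend I E u
  have hV := FiberBundle.mdifferentiableAt_extend I E v
  have cU := FiberBundle.contMDiffAt_extend (k := ∞) I E u
  have cV := FiberBundle.contMDiffAt_extend (k := ∞) I E v
  have h := hS.2 x _ _ cU cV
  -- As `dη = 0`, normality is the vanishing of the Nijenhuis tensor alone.
  rw [hS.1.1 x _ _ cU cV, mul_zero, zero_smul, add_zero, nijenhuis,
    ← leviCivita_torsion hU hV, ← leviCivita_torsion (S.mdiffAt_φ_apply hU) (S.mdiffAt_φ_apply hV),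
    ← leviCivita_torsion (S.mdiffAt_φ_apply hU) hV,
    ← leviCivita_torsion hU (S.mdiffAt_φ_apply hV)] at h
  simp only [FiberBundle.extend_apply_self, map_sub] at h
  simp only [S.nablaφ_extend, map_sub]
  rw [← h]
  abel

theorem IsCosymplectic.nablaφ_eq_zero (hS : S.IsCosymplectic) (x : N) : S.nablaφ x = 0 :=
  eq_zero_of_cosymplectic_identities (S.φ x).toLinearMap (S.ξ x) (S.nablaφ x)
    (leviCivita S.ξ x).toLinearMap (S.φ_ξ x)
    (fun v => by simpa [S.η_eq_inner] using S.φ_sq x v) (S.inner_φ_left x)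
    (S.inner_nablaφ_left x) (S.φ_nablaφ_add x) (S.nablaφ_ξ x) (S.inner_nablaξ_ξ x)
    (hS.inner_nablaξ_comm x) (hS.cyclic_nablaφ x) (hS.nijenhuis_nablaφ x)

/-- On a cosymplectic manifold `φ` is parallel. -/
theorem IsCosymplectic.leviCivita_φ_apply (hS : S.IsCosymplectic) {Y : Π x : N, TangentSpace I x}
    {x : N} (hY : MDiffAt (T% Y) x) (u : TangentSpace I x) :
    leviCivita (fun y => S.φ y (Y y)) x u = S.φ x (leviCivita Y x u) := by
  have h := S.nablaφ_apply hY u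
  rw [hS.nablaφ_eq_zero] at h
  exact sub_eq_zero.1 h.symm

end AlmostContactMetricStructure

/-! ### Coordinate vector fields -/

section CoordinateFields

variable {E : Type*} [NormedAddCommGroup E] [NormedSpace ℝ E]
  {N : Type*} [TopologicalSpace N] [ChartedSpace E N] [IsManifold 𝓘(ℝ, E) ∞ N]

/-- The vector field that is constant, equal to `w`, in the chart `ψ`. -/
noncomputable def coordField (ψ : OpenPartialHomeomorph N E) (w : E) (y : N) :
    TangentSpace 𝓘(ℝ, E) y :=
  VectorField.mpullback 𝓘(ℝ, E) 𝓘(ℝ, E) ψ (fun _ => w) y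

variable {ψ : OpenPartialHomeomorph N E} (hψ : ψ ∈ IsManifold.maximalAtlas 𝓘(ℝ, E) ∞ N)
include hψ

theorem mdifferentiable_of_mem_maximalAtlas :
    ψ.MDifferentiable 𝓘(ℝ, E) 𝓘(ℝ, E) :=
  ⟨(contMDiffOn_of_mem_maximalAtlas hψ).mdifferentiableOn (by simp),
    (contMDiffOn_symm_of_mem_maximalAtlas hψ).mdifferentiableOn (by simp)⟩

theorem isInvertible_mfderiv_chart {y : N} (hy : y ∈ ψ.source) :
    (mfderiv 𝓘(ℝ, E) 𝓘(ℝ, E) ψ y).IsInvertible :=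
  ⟨(mdifferentiable_of_mem_maximalAtlas hψ).mfderiv hy, rfl⟩

theorem mfderiv_coordField {y : N} (hy : y ∈ ψ.source) (w : E) :
    mfderiv 𝓘(ℝ, E) 𝓘(ℝ, E) ψ y (coordField ψ w y) = w :=
  (isInvertible_mfderiv_chart hψ hy).self_apply_inverse _

theorem coordField_mfderiv {y : N} (hy : y ∈ ψ.source) (v : TangentSpace 𝓘(ℝ, E) y) :
    coordField ψ (mfderiv 𝓘(ℝ, E) 𝓘(ℝ, E) ψ y v) y = v :=
  (isInvertible_mfderiv_chart hψ hy).inverse_apply_self _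

theorem contMDiffAt_coordField [CompleteSpace E] {y : N} (hy : y ∈ ψ.source) (w : E) :
    CMDiffAt ∞ (T% (coordField ψ w)) y := by
  refine ContMDiffAt.mpullback_vectorField_preimage (n := ∞) ?_
    (contMDiffAt_of_mem_maximalAtlas hψ hy) (isInvertible_mfderiv_chart hψ hy) (by simp)
  exact contMDiffAt_vectorSpace_iff_contDiffAt.2 contDiffAt_const

theorem mdiffAt_coordField [CompleteSpace E] {y : N} (hy : y ∈ ψ.source) (w : E) :
    MDiffAt (T% (coordField ψ w)) y :=
  (contMDiffAt_coordField hψ hy w).mdifferentiableAt (by simp)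

theorem mfderiv_chart_symm {u : E} (hu : u ∈ ψ.target) (w : E) :
    mfderiv 𝓘(ℝ, E) 𝓘(ℝ, E) ψ.symm u w = coordField ψ w (ψ.symm u) := by
  have hd := mdifferentiable_of_mem_maximalAtlas hψ
  have h := congrArg (fun A : E →L[ℝ] E => A w) (hd.comp_symm_deriv hu)
  have h2 := coordField_mfderiv hψ (ψ.map_target hu) (mfderiv 𝓘(ℝ, E) 𝓘(ℝ, E) ψ.symm u w)
  rw [← h2]
  exact congrArg (fun z : E => coordField ψ z (ψ.symm u)) h

end CoordinateFields

/-! ### Linear normal form of an immersion -/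

section ImmersionCharts

variable {E : Type*} [NormedAddCommGroup E] [NormedSpace ℝ E]
  {N : Type*} [TopologicalSpace N] [ChartedSpace E N] [IsManifold 𝓘(ℝ, E) ∞ N]
  {E' : Type*} [NormedAddCommGroup E'] [NormedSpace ℝ E']
  {M : Type*} [TopologicalSpace M] [ChartedSpace E' M] [IsManifold 𝓘(ℝ, E') ∞ M]

/-- Charts in which `f` is the restriction of an injective linear map `L`. -/
structure LinearizingCharts (f : M → N) (e : OpenPartialHomeomorph M E')
    (ψ : OpenPartialHomeomorph N E) (L : E' →L[ℝ] E) : Prop where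
  dom : e ∈ IsManifold.maximalAtlas 𝓘(ℝ, E') ∞ M
  cod : ψ ∈ IsManifold.maximalAtlas 𝓘(ℝ, E) ∞ N
  mapsTo : ∀ q ∈ e.source, f q ∈ ψ.source
  injective : Function.Injective L
  apply_eq : ∀ q ∈ e.source, ψ (f q) = L (e q)

theorem exists_linearizingCharts {f : M → N} {p : M}
    (hf : IsImmersionAt 𝓘(ℝ, E') 𝓘(ℝ, E) ∞ f p) :
    ∃ (e : OpenPartialHomeomorph M E') (ψ : OpenPartialHomeomorph N E) (L : E' →L[ℝ] E),
      p ∈ e.source ∧ LinearizingCharts f e ψ L := by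
  refine ⟨hf.domChart, hf.codChart,
    hf.equiv.toContinuousLinearMap ∘L ContinuousLinearMap.inl ℝ E' hf.complement,
    hf.mem_domChart_source, hf.domChart_mem_maximalAtlas, hf.codChart_mem_maximalAtlas,
    fun q hq => hf.source_subset_preimage_source hq, ?_, fun q hq => ?_⟩
  · intro a b h
    have := hf.equiv.injective h
    exact congrArg Prod.fst this
  · have hm : hf.domChart.extend 𝓘(ℝ, E') q ∈ (hf.domChart.extend 𝓘(ℝ, E')).target :=
      (hf.domChart.extend 𝓘(ℝ, E')).map_source (by simpa using hq)
    simpa [hq] using hf.writtenInCharts hm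

namespace LinearizingCharts

variable {f : M → N} {e : OpenPartialHomeomorph M E'} {ψ : OpenPartialHomeomorph N E}
  {L : E' →L[ℝ] E} (h : LinearizingCharts f e ψ L)
include h

/-- The chain rule for `ψ ∘ f = L ∘ e`. Coordinate fields of `M` thereby acquire the ambient
extensions that the second fundamental form requires. -/
theorem mfderiv_apply (hf : MDifferentiable 𝓘(ℝ, E') 𝓘(ℝ, E) f) {q : M} (hq : q ∈ e.source)
    (a : E') :
    mfderiv 𝓘(ℝ, E') 𝓘(ℝ, E) f q (coordField e a q) = coordField ψ (L a) (f q) := by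
  have hψ := mdifferentiable_of_mem_maximalAtlas h.cod
  have he := mdifferentiable_of_mem_maximalAtlas h.dom
  have hfq := h.mapsTo q hq
  refine hψ.mfderiv_injective hfq ?_
  rw [mfderiv_coordField h.cod hfq]
  have h1 : (ψ ∘ f) =ᶠ[nhds q] (L ∘ e) := by
    filter_upwards [e.open_source.mem_nhds hq] with r hr using h.apply_eq r hr
  have h2 := h1.mfderiv_eq (I := 𝓘(ℝ, E')) (I' := 𝓘(ℝ, E))
  rw [mfderiv_comp q (hψ.mdifferentiableAt hfq) (hf q),
    mfderiv_comp q L.differentiableAt.mdifferentiableAt (he.mdifferentiableAt hq)] at h2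
  have h3 := congrArg (fun A : TangentSpace 𝓘(ℝ, E') q →L[ℝ] E => A (coordField e a q)) h2
  refine h3.trans ?_
  rw [mfderiv_eq_fderiv, ContinuousLinearMap.fderiv]
  exact congrArg L (mfderiv_coordField h.dom hq a)

theorem range_mfderiv (hf : MDifferentiable 𝓘(ℝ, E') 𝓘(ℝ, E) f) {q : M} (hq : q ∈ e.source)
    {ι : Type*} [Fintype ι] (b : Module.Basis ι ℝ E') :
    tangentSubspace 𝓘(ℝ, E) 𝓘(ℝ, E') f q = LinearMap.range
      (Fintype.linearCombination ℝ (fun i => coordField ψ (L (b i)) (f q))) := by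
  apply le_antisymm
  · rintro _ ⟨v, rfl⟩
    set a : E' := mfderiv 𝓘(ℝ, E') 𝓘(ℝ, E') e q v with ha
    refine ⟨b.repr a, ?_⟩
    have hv := coordField_mfderiv h.dom hq v
    have hlin : coordField e a q = ∑ i, b.repr a i • coordField e (b i) q := by
      conv_lhs => rw [← b.sum_repr a]
      exact (map_sum (ContinuousLinearMap.inverse (mfderiv 𝓘(ℝ, E') 𝓘(ℝ, E') e q)) _ _).trans
        (Finset.sum_congr rfl fun i _ => map_smul
          (ContinuousLinearMap.inverse (mfderiv 𝓘(ℝ, E') 𝓘(ℝ, E') e q)) _ _)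
    rw [Fintype.linearCombination_apply, ← hv, ← ha, hlin]
    simp only [ContinuousLinearMap.coe_coe, map_sum, map_smul, h.mfderiv_apply hf hq]
  · rintro _ ⟨a, rfl⟩
    rw [Fintype.linearCombination_apply]
    refine Submodule.sum_mem _ fun i _ => Submodule.smul_mem _ _ ?_
    exact ⟨_, h.mfderiv_apply hf hq (b i)⟩

theorem linearIndependent_coordField {q : M} (hq : q ∈ e.source)
    {ι : Type*} [Fintype ι] (b : Module.Basis ι ℝ E') :
    LinearIndependent ℝ (fun i => coordField ψ (L (b i)) (f q)) := by
  have h1 : LinearIndependent ℝ (L ∘ b) :=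
    b.linearIndependent.map' L.toLinearMap (LinearMap.ker_eq_bot.2 h.injective)
  refine LinearIndependent.of_comp (mfderiv 𝓘(ℝ, E) 𝓘(ℝ, E) ψ (f q)).toLinearMap ?_
  convert! h1 using 1
  funext i
  exact mfderiv_coordField h.cod (h.mapsTo q hq) _

/-- The derivative of a function on `N` along the image of a coordinate segment in `M`. -/
theorem hasDerivAt_comp_segment (hf : MDifferentiable 𝓘(ℝ, E') 𝓘(ℝ, E) f) {k : N → ℝ}
    {u w : E'} {s : ℝ} (hs : u + s • w ∈ e.target)
    (hk : MDifferentiableAt 𝓘(ℝ, E) 𝓘(ℝ, ℝ) k (f (e.symm (u + s • w)))) :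
    HasDerivAt (fun r : ℝ => k (f (e.symm (u + r • w))))
      (mvfderiv 𝓘(ℝ, E) k (f (e.symm (u + s • w)))
        (coordField ψ (L w) (f (e.symm (u + s • w))))) s := by
  have he := mdifferentiable_of_mem_maximalAtlas h.dom
  have h1 := (he.mdifferentiableAt_symm hs).hasMFDerivAt
  have h2 := ((hk.hasMFDerivAt.comp _ (hf _).hasMFDerivAt).comp _ h1).hasFDerivAt
  have h3 : HasDerivAt (fun r : ℝ => u + r • w) w s := by
    simpa using ((hasDerivAt_id s).smul_const w).const_add u
  refine (h2.comp_hasDerivAt s h3).congr_deriv ?_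
  rw [← h.mfderiv_apply hf (e.map_target hs), ← mfderiv_chart_symm h.dom hs]
  rfl

end LinearizingCharts

end ImmersionCharts

/-! ### Parallel fields of endomorphisms -/

section ParallelEndomorphisms

variable {E : Type*} [NormedAddCommGroup E] [NormedSpace ℝ E] [FiniteDimensional ℝ E]
  {H : Type*} [TopologicalSpace H] {I : ModelWithCorners ℝ E H}
  {N : Type*} [TopologicalSpace N] [ChartedSpace H N] [IsManifold I ∞ N]
  [RiemannianBundle (fun x : N => TangentSpace I x)]
  [IsContMDiffRiemannianBundle I ∞ E (fun x : N => TangentSpace I x)]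

/-- A field of endomorphisms that preserves differentiability of vector fields and commutes with
the Levi-Civita connection. -/
structure IsParallelEndomorphism
    (Λ : Π x : N, TangentSpace I x →ₗ[ℝ] TangentSpace I x) : Prop where
  mdiffAt : ∀ {Y : Π x : N, TangentSpace I x} {x : N}, MDiffAt (T% Y) x →
    MDiffAt (T% (fun y => Λ y (Y y))) x
  leviCivita_apply : ∀ {Y : Π x : N, TangentSpace I x} {x : N}, MDiffAt (T% Y) x →
    ∀ u : TangentSpace I x, leviCivita (fun y => Λ y (Y y)) x u = Λ x (leviCivita Y x u)

theorem isParallelEndomorphism_id :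
    IsParallelEndomorphism (fun x : N => (LinearMap.id : TangentSpace I x →ₗ[ℝ] _)) :=
  ⟨fun hY => hY, fun _ _ => rfl⟩

variable {S : AlmostContactMetricStructure I N}

theorem AlmostContactMetricStructure.IsCosymplectic.isParallelEndomorphism_φ
    (hS : S.IsCosymplectic) : IsParallelEndomorphism (fun x : N => (S.φ x).toLinearMap) :=
  ⟨fun hY => S.mdiffAt_φ_apply hY, fun hY u => hS.leviCivita_φ_apply hY u⟩

/-- This endomorphism is `η ⊗ ξ`; written through `φ`, its parallelism needs nothing about `∇ξ`. -/
theorem AlmostContactMetricStructure.IsCosymplectic.isParallelEndomorphism_φ_sq_add_id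
    (hS : S.IsCosymplectic) :
    IsParallelEndomorphism (fun x : N =>
      (S.φ x).toLinearMap ∘ₗ (S.φ x).toLinearMap + LinearMap.id) :=
  ⟨fun hY => mdifferentiableAt_add_section (S.mdiffAt_φ_apply (S.mdiffAt_φ_apply hY)) hY,
    fun {Y x} hY u => by
      have h := (leviCivita (I := I) (N := N)).isCovariantDerivativeOnUniv.add
        (S.mdiffAt_φ_apply (S.mdiffAt_φ_apply hY)) hY
      have h2 := congrArg (fun A : TangentSpace I x →L[ℝ] TangentSpace I x => A u) h
      have h3 := hS.leviCivita_φ_apply (S.mdiffAt_φ_apply hY) u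
      rw [hS.leviCivita_φ_apply hY] at h3
      refine h2.trans ?_
      exact congrArg (· + leviCivita Y x u) h3⟩

end ParallelEndomorphisms

/-! ### Constancy of the slant function -/

section LocalConstancy

variable {E : Type*} [NormedAddCommGroup E] [NormedSpace ℝ E] [FiniteDimensional ℝ E]
  {N : Type*} [TopologicalSpace N] [ChartedSpace E N] [IsManifold 𝓘(ℝ, E) ∞ N]
  [RiemannianBundle (fun x : N => TangentSpace 𝓘(ℝ, E) x)]
  [IsContMDiffRiemannianBundle 𝓘(ℝ, E) ∞ E (fun x : N => TangentSpace 𝓘(ℝ, E) x)]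
  {E' : Type*} [NormedAddCommGroup E'] [NormedSpace ℝ E'] [FiniteDimensional ℝ E']
  {M : Type*} [TopologicalSpace M] [ChartedSpace E' M] [IsManifold 𝓘(ℝ, E') ∞ M]
  {f : M → N} {e : OpenPartialHomeomorph M E'} {ψ : OpenPartialHomeomorph N E}
  {L : E' →L[ℝ] E} {ι : Type*} [Fintype ι]

/-- The coordinate frame of the submanifold in linearizing charts, as vectors tangent to `N`. -/
noncomputable def coordFrame (ψ : OpenPartialHomeomorph N E) (L : E' →L[ℝ] E)
    (b : Module.Basis ι ℝ E') (y : N) (i : ι) : TangentSpace 𝓘(ℝ, E) y :=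
  coordField ψ (L (b i)) y

theorem LinearizingCharts.exists_christoffel (h : LinearizingCharts f e ψ L)
    (hf : MDifferentiable 𝓘(ℝ, E') 𝓘(ℝ, E) f)
    (hgeo : IsTotallyGeodesic 𝓘(ℝ, E) 𝓘(ℝ, E') f) (b : Module.Basis ι ℝ E') {q : M}
    (hq : q ∈ e.source) (a : E') :
    ∃ Γ : Matrix ι ι ℝ, ∀ j,
      leviCivita (fun y => coordFrame ψ L b y j) (f q) (coordField ψ (L a) (f q))
        = ∑ k, Γ k j • coordFrame ψ L b (f q) k := by
  have key (j : ι) : leviCivita (fun y => coordFrame ψ L b y j) (f q) (coordField ψ (L a) (f q))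
      ∈ LinearMap.range (Fintype.linearCombination ℝ (coordFrame ψ L b (f q))) := by
    have h1 := hgeo q (coordField e a q) (coordField e (b j)) (coordField ψ (L (b j)))
      (contMDiffAt_coordField h.dom hq _) (contMDiffAt_coordField h.cod (h.mapsTo q hq) _)
      (by
        filter_upwards [e.open_source.mem_nhds hq] with r hr
        exact (h.mfderiv_apply hf hr _).symm)
    -- A vanishing normal component puts the derivative in the double orthogonal complement of the
    -- tangent space, which is the tangent space itself.
    rw [secondFundamentalForm, Submodule.starProjection_apply_eq_zero_iff,
      Submodule.orthogonal_orthogonal, h.mfderiv_apply hf hq, h.range_mfderiv hf hq b] at h1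
    exact h1
  choose c hc using key
  refine ⟨fun k j => c j k, fun j => ?_⟩
  rw [← hc j, Fintype.linearCombination_apply]

variable [DecidableEq ι]

/-- Metric compatibility and parallelism of `Λ` leave only derivatives of the two frame vectors,
which `Γ` expresses in the frame. -/
theorem LinearizingCharts.hasDerivAt_formMatrix (h : LinearizingCharts f e ψ L)
    (hf : MDifferentiable 𝓘(ℝ, E') 𝓘(ℝ, E) f) (b : Module.Basis ι ℝ E')
    {Λ : Π x : N, TangentSpace 𝓘(ℝ, E) x →ₗ[ℝ] TangentSpace 𝓘(ℝ, E) x}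
    (hΛ : IsParallelEndomorphism Λ) {u w : E'} {s : ℝ} (hs : u + s • w ∈ e.target)
    {Γ : Matrix ι ι ℝ}
    (hΓ : ∀ j, leviCivita (fun y => coordFrame ψ L b y j) (f (e.symm (u + s • w)))
        (coordField ψ (L w) (f (e.symm (u + s • w))))
      = ∑ k, Γ k j • coordFrame ψ L b (f (e.symm (u + s • w))) k) (i j : ι) :
    HasDerivAt (fun r : ℝ => formMatrix (coordFrame ψ L b (f (e.symm (u + r • w))))
        (Λ (f (e.symm (u + r • w)))) i j)
      ((Γ.transpose * formMatrix (coordFrame ψ L b (f (e.symm (u + s • w))))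
          (Λ (f (e.symm (u + s • w))))
        + formMatrix (coordFrame ψ L b (f (e.symm (u + s • w))))
          (Λ (f (e.symm (u + s • w)))) * Γ) i j) s := by
  have hq := h.mapsTo _ (e.map_target hs)
  have hd (i : ι) := mdiffAt_coordField h.cod hq (L (b i))
  have h1 := h.hasDerivAt_comp_segment hf hs
    (k := fun y => inner ℝ (coordField ψ (L (b i)) y) (Λ y (coordField ψ (L (b j)) y)))
    (mdiffAt_inner (hd i) (hΛ.mdiffAt (hd j)))
  refine h1.congr_deriv ?_
  have hi := hΓ i
  have hj := hΓ j
  set y := f (e.symm (u + s • w)) with hy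
  have h2 := leviCivita_metric_apply (hd i) (hΛ.mdiffAt (hd j)) (coordField ψ (L w) y)
  rw [h2, hΛ.leviCivita_apply (hd j)]
  change inner ℝ (leviCivita (fun y => coordFrame ψ L b y i) y _) _
    + inner ℝ _ (Λ y (leviCivita (fun y => coordFrame ψ L b y j) y _)) = _
  rw [hi, hj]
  simp only [sum_inner, map_sum, inner_sum, map_smul, inner_smul_left, inner_smul_right,
    Matrix.add_apply, Matrix.mul_apply, Matrix.transpose_apply, formMatrix, Matrix.of_apply]
  congr 1
  exact Finset.sum_congr rfl fun k _ => mul_comm _ _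

theorem formMatrix_φ_sq_add_id (S : AlmostContactMetricStructure 𝓘(ℝ, E) N) (y : N)
    (v : ι → TangentSpace 𝓘(ℝ, E) y) :
    formMatrix v ((S.φ y).toLinearMap ∘ₗ (S.φ y).toLinearMap + LinearMap.id :
        TangentSpace 𝓘(ℝ, E) y →ₗ[ℝ] TangentSpace 𝓘(ℝ, E) y)
      = Matrix.vecMulVec (fun i => inner ℝ (v i) (S.ξ y)) (fun i => inner ℝ (v i) (S.ξ y)) := by
  ext i j
  simp [formMatrix, Matrix.vecMulVec_apply, S.φ_sq, S.η_eq_inner, inner_smul_right,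
    real_inner_comm (S.ξ y), mul_comm]

theorem norm_φ_of_inner_ξ_eq_zero (S : AlmostContactMetricStructure 𝓘(ℝ, E) N) (y : N)
    (v : TangentSpace 𝓘(ℝ, E) y) (hv : inner ℝ v (S.ξ y) = (0 : ℝ)) : ‖S.φ y v‖ = ‖v‖ := by
  have h := S.inner_φ_φ y v v
  rw [S.η_eq_inner, real_inner_comm v (S.ξ y), hv, mul_zero, sub_zero, real_inner_self_eq_norm_sq,
    real_inner_self_eq_norm_sq] at h
  exact (sq_eq_sq₀ (norm_nonneg _) (norm_nonneg _)).1 h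

/-- The slant function does not change along a coordinate segment. -/
theorem LinearizingCharts.slant_eq_of_segment (h : LinearizingCharts f e ψ L)
    (hf : MDifferentiable 𝓘(ℝ, E') 𝓘(ℝ, E) f) {S : AlmostContactMetricStructure 𝓘(ℝ, E) N}
    (hS : S.IsCosymplectic) (hgeo : IsTotallyGeodesic 𝓘(ℝ, E) 𝓘(ℝ, E') f) {θ : M → ℝ}
    (hθ : IsSlantFunction 𝓘(ℝ, E') S f θ) {u w : E'}
    (hseg : ∀ s ∈ Set.Icc (0 : ℝ) 1, u + s • w ∈ e.target) :
    (slantSubspace 𝓘(ℝ, E') S f (e.symm (u + (1 : ℝ) • w)) = ⊥ ↔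
      slantSubspace 𝓘(ℝ, E') S f (e.symm (u + (0 : ℝ) • w)) = ⊥) ∧
    (slantSubspace 𝓘(ℝ, E') S f (e.symm (u + (0 : ℝ) • w)) ≠ ⊥ →
      Real.cos (θ (e.symm (u + (1 : ℝ) • w))) ^ 2
        = Real.cos (θ (e.symm (u + (0 : ℝ) • w))) ^ 2) := by
  set b := Module.finBasis ℝ E'
  set c : ℝ → M := fun s => e.symm (u + s • w) with hc
  have hsrc (s) (hs : s ∈ Set.Icc (0 : ℝ) 1) : c s ∈ e.source := e.map_target (hseg s hs)
  choose! Γ hΓ using fun s (hs : s ∈ Set.Icc (0 : ℝ) 1) =>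
    h.exists_christoffel hf hgeo b (hsrc s hs) w
  have hli (s) (hs : s ∈ Set.Icc (0 : ℝ) 1) :
      LinearIndependent ℝ (coordFrame ψ L b (f (c s))) :=
    h.linearIndependent_coordField (hsrc s hs) b
  have hK (s) (hs : s ∈ Set.Icc (0 : ℝ) 1) : slantSubspace 𝓘(ℝ, E') S f (c s)
      = LinearMap.range (Fintype.linearCombination ℝ (coordFrame ψ L b (f (c s))))
        ⊓ (Submodule.span ℝ {S.ξ (f (c s))})ᗮ :=
    congrArg (· ⊓ (Submodule.span ℝ {S.ξ (f (c s))})ᗮ) (h.range_mfderiv hf (hsrc s hs) b)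
  have htr := trace_eq_of_formTransport (Γ := Γ)
    (fun s hs => h.hasDerivAt_formMatrix hf b isParallelEndomorphism_id (hseg s hs) (hΓ s hs))
    (fun s hs => h.hasDerivAt_formMatrix hf b hS.isParallelEndomorphism_φ (hseg s hs) (hΓ s hs))
    (fun s hs => h.hasDerivAt_formMatrix hf b hS.isParallelEndomorphism_φ_sq_add_id
      (hseg s hs) (hΓ s hs))
    (fun s hs => isUnit_det_formMatrix (hli s hs))
  have h0 : (0 : ℝ) ∈ Set.Icc (0 : ℝ) 1 := by simp
  have h1 : (1 : ℝ) ∈ Set.Icc (0 : ℝ) 1 := by simp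
  have hz (s) (hs : s ∈ Set.Icc (0 : ℝ) 1) := trace_kernelProjMatrix_eq_zero_iff (hli s hs)
    (formMatrix_φ_sq_add_id S (f (c s)) _) (hK s hs)
  have ht (s) (hs : s ∈ Set.Icc (0 : ℝ) 1) := trace_compressedMatrix_sq (hli s hs)
    (formMatrix_φ_sq_add_id S (f (c s)) _) (φ := (S.φ (f (c s))).toLinearMap)
    (S.inner_φ_left (f (c s))) (norm_φ_of_inner_ξ_eq_zero S (f (c s))) (hK s hs)
    (θ := θ (c s)) (hθ (c s))
  have hz0 := hz 0 h0
  have hz1 := hz 1 h1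
  have ht0 := ht 0 h0
  have ht1 := ht 1 h1
  obtain ⟨e1, e2⟩ := htr
  refine ⟨?_, fun hne => ?_⟩
  · rw [← hz0, ← hz1]
    exact Eq.congr_left e1
  -- The common factor `tr P`, the dimension of `M_p`, is nonzero and cancels.
  · have hne' := mt hz0.1 hne
    have e3 := ht1.symm.trans (e2.trans ht0)
    have e4 := e3.trans (congrArg (_ * ·) e1.symm)
    have hne1 := mt e1.symm.trans hne'
    linarith [mul_right_cancel₀ hne1 e4]

theorem IsSlantFunction.cos_nonneg {S : AlmostContactMetricStructure 𝓘(ℝ, E) N} {θ : M → ℝ}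
    (hθ : IsSlantFunction 𝓘(ℝ, E') S f θ) {p : M} (hp : slantSubspace 𝓘(ℝ, E') S f p ≠ ⊥) :
    0 ≤ Real.cos (θ p) ∧ θ p ∈ Set.Icc 0 Real.pi := by
  obtain ⟨X, hX, hX0⟩ := Submodule.exists_mem_ne_zero_of_ne_bot hp
  rw [← hθ p X hX hX0]
  exact ⟨cos_angleWithSubspace_nonneg _ _, InnerProductGeometry.angle_nonneg _ _,
    InnerProductGeometry.angle_le_pi _ _⟩

/-- Near each point, the slant function of a totally geodesic submanifold of a cosymplectic
manifold is constant wherever it is determined. -/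
theorem eventually_slant_eq {S : AlmostContactMetricStructure 𝓘(ℝ, E) N}
    (hS : S.IsCosymplectic) (hf : IsImmersion 𝓘(ℝ, E') 𝓘(ℝ, E) ∞ f)
    (hgeo : IsTotallyGeodesic 𝓘(ℝ, E) 𝓘(ℝ, E') f) {θ : M → ℝ}
    (hθ : IsSlantFunction 𝓘(ℝ, E') S f θ) (p : M) :
    ∀ᶠ q in nhds p, (slantSubspace 𝓘(ℝ, E') S f q = ⊥ ↔ slantSubspace 𝓘(ℝ, E') S f p = ⊥) ∧
      (slantSubspace 𝓘(ℝ, E') S f p ≠ ⊥ → θ q = θ p) := by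
  obtain ⟨e, ψ, L, hp, h⟩ := exists_linearizingCharts (hf.isImmersionAt p)
  have hfd : MDifferentiable 𝓘(ℝ, E') 𝓘(ℝ, E) f := hf.contMDiff.mdifferentiable (by simp)
  obtain ⟨r, hr, hball⟩ := Metric.isOpen_iff.1 e.open_target (e p) (e.map_source hp)
  have hnhds : e ⁻¹' Metric.ball (e p) r ∈ nhds p :=
    (e.continuousAt hp).preimage_mem_nhds (Metric.ball_mem_nhds _ hr)
  filter_upwards [e.open_source.mem_nhds hp, hnhds] with q hq hqr
  -- A ball in the chart is convex, so straight segments from `p` reach every nearby point.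
  have hseg (s : ℝ) (hs : s ∈ Set.Icc (0 : ℝ) 1) : e p + s • (e q - e p) ∈ e.target :=
    hball ((convex_ball (e p) r).add_smul_sub_mem (Metric.mem_ball_self hr) hqr hs)
  have key := h.slant_eq_of_segment hfd hS hgeo hθ hseg
  rw [one_smul, zero_smul, add_zero, add_sub_cancel, e.left_inv hp, e.left_inv hq] at key
  refine ⟨key.1, fun hne => ?_⟩
  have hp' := hθ.cos_nonneg hne
  have hq' := hθ.cos_nonneg (mt key.1.1 hne)
  exact Real.injOn_cos hq'.2 hp'.2 ((sq_eq_sq₀ hq'.1 hp'.1).1 (key.2 hne))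

theorem isSlant_of_isPointwiseSlant [PreconnectedSpace M]
    {S : AlmostContactMetricStructure 𝓘(ℝ, E) N} (hS : S.IsCosymplectic)
    (hf : IsImmersion 𝓘(ℝ, E') 𝓘(ℝ, E) ∞ f) (hgeo : IsTotallyGeodesic 𝓘(ℝ, E) 𝓘(ℝ, E') f)
    (hslant : IsPointwiseSlant 𝓘(ℝ, E') S f) : IsSlant 𝓘(ℝ, E') S f := by
  classical
  obtain ⟨θ, hθ⟩ := hslant
  -- Where `M_q = 0` the value `θ q` is arbitrary, so `κ` records `none` there; this makes `κ`
  -- locally constant although `θ` need not be.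
  set κ : M → Option ℝ :=
    fun q => if slantSubspace 𝓘(ℝ, E') S f q = ⊥ then none else some (θ q) with hκ
  have hloc : IsLocallyConstant κ := (IsLocallyConstant.iff_eventually_eq κ).2 fun p => by
    filter_upwards [eventually_slant_eq hS hf hgeo hθ p] with q hq
    by_cases hp : slantSubspace 𝓘(ℝ, E') S f p = ⊥
    · simp [hκ, hp, hq.1.2 hp]
    · simp [hκ, hp, mt hq.1.1 hp, hq.2 hp]
  by_cases hex : ∃ p, slantSubspace 𝓘(ℝ, E') S f p ≠ ⊥
  · obtain ⟨p, hp⟩ := hex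
    refine ⟨θ p, fun q X hX hX0 => (hθ q X hX hX0).trans ?_⟩
    have hq : slantSubspace 𝓘(ℝ, E') S f q ≠ ⊥ :=
      fun h0 => hX0 ((Submodule.eq_bot_iff _).1 h0 X hX)
    have := hloc.apply_eq_of_preconnectedSpace q p
    simpa [hκ, hp, hq] using this
  · push Not at hex
    -- Every `M_q` is zero, so any constant serves.
    exact ⟨0, fun q X hX hX0 => (hX0 ((Submodule.eq_bot_iff _).1 (hex q) X hX)).elim⟩

end LocalConstancy

end SlantGeometry

theorem theorem4p6 (n m : ℕ)
    {N : Type*} [TopologicalSpace N] [T2Space N]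
    [ChartedSpace (EuclideanSpace ℝ (Fin (2 * n + 1))) N] [IsManifold (𝓡 (2 * n + 1)) ∞ N]
    [RiemannianBundle (fun x : N => TangentSpace (𝓡 (2 * n + 1)) x)]
    [IsContMDiffRiemannianBundle (𝓡 (2 * n + 1)) ∞ (EuclideanSpace ℝ (Fin (2 * n + 1)))
      (fun x : N => TangentSpace (𝓡 (2 * n + 1)) x)]
    (S : SlantGeometry.AlmostContactMetricStructure (𝓡 (2 * n + 1)) N)
    (hS : S.IsCosymplectic)
    {M : Type*} [TopologicalSpace M] [T2Space M] [ConnectedSpace M]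
    [ChartedSpace (EuclideanSpace ℝ (Fin m)) M] [IsManifold (𝓡 m) ∞ M]
    (f : M → N) (hf : IsImmersion (𝓡 m) (𝓡 (2 * n + 1)) ∞ f)
    (hgeo : SlantGeometry.IsTotallyGeodesic (𝓡 (2 * n + 1)) (𝓡 m) f)
    (hslant : SlantGeometry.IsPointwiseSlant (𝓡 m) S f) :
    SlantGeometry.IsSlant (𝓡 m) S f :=
  SlantGeometry.isSlant_of_isPointwiseSlant hS hf hgeo hslant
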